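/- Let $d\ge 2$ and $m\ge 3$ be integers and let $\frac{2m-3}{2m-2}<\alpha<1$. Let $\mathcal B_d$ be the open unit ball of $\mathbb R^d$ with origin $o$, with the Riemannian metric $ds^2=4|dx|^2/(1-|x|^2)^2$ and its hyperbolic distance $d_H$, i.e. $\cosh d_H(x,y)=1+\frac{2|x-y|^2}{(1-|x|^2)(1-|y|^2)}$. For $n\ge1$ put $$R_n=\frac{2}{d-1}\log n,\qquad \omega_n=\log\log R_n$$ (for the finitely many $n$ with $R_n\le 1$, where the iterated logarithm is undefined, read $\omega_n=\log|\log R_n|$ if $0<R_n\le1$; for $n=1$ the interval $(0,R_n)$ below is empty). A point $p$ of the hyperbolic ball $B(o,R_n)$ is written $p=(t,\theta)$, where $t=R_n-d_H(o,p)\in[0,R_n]$ and $\theta\in\mathcal A_d=[0,\pi]^{d-2}\times[0,2\pi)$ are the spherical angles of $p$. Let $X_1,X_2,\dots$ be i.i.d. random points of $B(o,R_n)$ whose coordinates $(t,\theta)$ have density $\bar\rho_{n,\alpha}(t)\,\pi(\theta)$, where $$\bar\rho_{n,\alpha}(t)=\frac{\sinh^{d-1}(\alpha(R_n-t))}{\int_0^{R_n}\sinh^{d-1}(\alpha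 s)\,ds}\quad(0\le t\le R_n),\qquad \pi(\theta)=\frac{\prod_{i=1}^{d-2}\sin^{d-i-1}\theta_i}{2\prod_{i=1}^{d-1}\int_0^\pi\sin^{d-i-1}s\,ds}\quad(\theta\in\mathcal A_d),$$ let $N_n$ be a Poisson random variable with mean $n$ that is independent of $(X_i)_{i\ge1}$, and let $\mathcal P_n=\{X_1,\dots,X_{N_n}\}$. For $u\in(0,R_n)$ let $p=(u,\mathbf 0)$ with $\mathbf 0=(0,\dots,0)\in\mathcal A_d$, and let $\mathcal C_{m,n}(u)$ be the number of $(m-1)$-tuples $(Y_1,\dots,Y_{m-1})$ of pairwise distinct points of $\mathcal P_n$ such that $d_H(Y_i,Y_j)\le R_n$ and $d_H(Y_i,p)\le R_n$ for all $1\le i,j\le m-1$ and $V_1\le\cdots\le V_{m-1}\le u$, where $V_i=R_n-d_H(o,Y_i)$. Then there are constants $C,c_1\in(0,\infty)$, depending only on $d$, $m$ and $\alpha$, such that for all $n\ge1$ and all $u\in(0,R_n)$ the random variable $\mathcal C_{m,n}(u)$ is square-integrable and $$\mathrm{Var}\big(\mathcal C_{m,n}(u)\big)\le C\,e^{c_1\omega_n}\,e^{\frac12(d-1)(2m-3-(2m-4)\alpha)u}.$$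 -/

import Mathlib

open MeasureTheory ProbabilityTheory

namespace HypRGG

noncomputable section

/-- The hyperbolic radius `R_n = (2 / (d - 1)) log n`. -/
def radius (d n : ℕ) : ℝ := 2 / ((d : ℝ) - 1) * Real.log n

/-- `ω_n = log log R_n`. The iterated logarithm only makes sense for `R_n > 1`; for the finitely
many smaller `n` the absolute value fixes a finite value of `ω_n`. -/
def omega (d n : ℕ) : ℝ := Real.log |Real.log (radius d n)|

/-- The hyperbolic distance of the Poincaré ball, that is of the unit ball of `ℝ^d` with the
Riemannian metric `ds² = 4 |dx|² / (1 - |x|²)²`: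
`cosh (dH x y) = 1 + 2 |x - y|² / ((1 - |x|²) (1 - |y|²))`. -/
def dH {d : ℕ} (x y : EuclideanSpace ℝ (Fin d)) : ℝ :=
  Real.arcosh (1 + 2 * ‖x - y‖ ^ 2 / ((1 - ‖x‖ ^ 2) * (1 - ‖y‖ ^ 2)))

/-- The unit vector with spherical angles `θ_1, …, θ_{d-1}` (here `θ_{i+1}` is `θ i`):
`(cos θ_1, sin θ_1 cos θ_2, …, sin θ_1 ⋯ sin θ_{d-2} cos θ_{d-1}, sin θ_1 ⋯ sin θ_{d-1})`. -/
def direction (d : ℕ) (θ : Fin (d - 1) → ℝ) : EuclideanSpace ℝ (Fin d) :=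
  WithLp.toLp 2 fun j =>
    (∏ i : Fin (d - 1), if i.val < j.val then Real.sin (θ i) else 1) *
      (if h : j.val < d - 1 then Real.cos (θ ⟨j.val, h⟩) else 1)

/-- The point of the Poincaré ball with polar coordinates `(t, θ)`, the radial coordinate `t` being
measured from the boundary of the hyperbolic ball `B(o, R)`: it lies in direction `θ`, at hyperbolic
distance `R - t` from the origin, that is at Euclidean distance `tanh ((R - t) / 2)`. -/
def polarPoint (d : ℕ) (R : ℝ) (x : ℝ × (Fin (d - 1) → ℝ)) : EuclideanSpace ℝ (Fin d) :=
  Real.tanh ((R - x.1) / 2) • direction d x.2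

/-- The density of the radial coordinate `t ∈ [0, R]`. -/
def radialDensity (d : ℕ) (α R t : ℝ) : ℝ :=
  Real.sinh (α * (R - t)) ^ (d - 1) / ∫ s in (0 : ℝ)..R, Real.sinh (α * s) ^ (d - 1)

/-- The set of angles `[0, π]^{d-2} × [0, 2π)`. -/
def angles (d : ℕ) : Set (Fin (d - 1) → ℝ) :=
  {θ | ∀ i, 0 ≤ θ i ∧ if i.val + 2 < d then θ i ≤ Real.pi else θ i < 2 * Real.pi}

/-- The uniform density of the angles:
`∏_{i=1}^{d-2} sin^{d-i-1} θ_i / (2 ∏_{i=1}^{d-1} ∫_0^π sin^{d-i-1})`. The index `i` below is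
shifted by one; the last factor of the product in the numerator is `sin^0 = 1`. -/
def angularDensity (d : ℕ) (θ : Fin (d - 1) → ℝ) : ℝ :=
  (∏ i : Fin (d - 1), Real.sin (θ i) ^ (d - 2 - i.val)) /
    (2 * ∏ i : Fin (d - 1), ∫ s in (0 : ℝ)..Real.pi, Real.sin s ^ (d - 2 - i.val))

/-- The law of the radial coordinate. -/
def radialLaw (d : ℕ) (α R : ℝ) : Measure ℝ :=
  (volume.restrict (Set.Icc 0 R)).withDensity fun t => ENNReal.ofReal (radialDensity d α R t)

/-- The law of the angular coordinates. -/
def angularLaw (d : ℕ) : Measure (Fin (d - 1) → ℝ) :=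
  (volume.restrict (angles d)).withDensity fun θ => ENNReal.ofReal (angularDensity d θ)

/-- The law of one vertex: independent radial and angular coordinates with the above densities. -/
def vertexLaw (d : ℕ) (α R : ℝ) : Measure (EuclideanSpace ℝ (Fin d)) :=
  ((radialLaw d α R).prod (angularLaw d)).map (polarPoint d R)

/-- `{X 0, …, X (N - 1)}` is the Poisson point process with intensity `n` times the law of a vertex:
the `X i` are i.i.d. with that law, and `N` is independent of them and Poisson with mean `n`. -/
structure IsVertexProcess (d n : ℕ) (α : ℝ) {Ω : Type*} [MeasurableSpace Ω] (P : Measure Ω)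
    (N : Ω → ℕ) (X : ℕ → Ω → EuclideanSpace ℝ (Fin d)) : Prop where
  measurable_card : Measurable N
  law_card : P.map N = poissonMeasure (n : NNReal)
  measurable_point : ∀ i, Measurable (X i)
  law_point : ∀ i, P.map (X i) = vertexLaw d α (radius d n)
  indep_points : iIndepFun X P
  indep_card : IndepFun N (fun ω i => X i ω) P

/-- The random set of vertices `{X 0, …, X (N - 1)}`. -/
def vertices {d : ℕ} {Ω : Type*} (N : Ω → ℕ) (X : ℕ → Ω → EuclideanSpace ℝ (Fin d)) (ω : Ω) :
    Set (EuclideanSpace ℝ (Fin d)) :=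
  {x | ∃ i < N ω, X i ω = x}

/-- The number of `(m - 1)`-tuples `(Y_1, …, Y_{m-1})` of pairwise distinct points of `S` that form
an `m`-clique together with `p`, where two points are joined if their hyperbolic distance is at most
`R`, and whose radial coordinates `V_i = R - dH o Y_i`, `u = R - dH o p` satisfy
`V_1 ≤ ⋯ ≤ V_{m-1} ≤ u`. -/
def cliqueCount {d : ℕ} (m : ℕ) (R : ℝ) (S : Set (EuclideanSpace ℝ (Fin d)))
    (p : EuclideanSpace ℝ (Fin d)) : ℕ :=
  Set.ncard {Y : Fin (m - 1) → EuclideanSpace ℝ (Fin d) |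
    (∀ i, Y i ∈ S) ∧ Function.Injective Y ∧
    (∀ i j, dH (Y i) (Y j) ≤ R) ∧ (∀ i, dH (Y i) p ≤ R) ∧
    Monotone (fun i => R - dH 0 (Y i)) ∧ (∀ i, R - dH 0 (Y i) ≤ R - dH 0 p)}

end

end HypRGG

namespace HypRGG

open scoped ENNReal

/-! Give a vertex x the height h(x) = R_n - d_H(o, x), and put a = (d-1)/2 and η = (d-1)(1-α).
Hyperbolic geometry enters only through `NeighbourBound`: under the Poisson intensity, the
neighbours of w with height in dt have mass at most K exp(a h(w) - (a-η) t) dt. Indeed, adjacent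
vertices at heights s and t enclose an angle O(exp((s+t-R_n)/2)) (`norm_sub_le_of_dH_le`), a
spherical cap of radius r has measure O(r^(d-1)) (`exists_lintegral_cap_le`), the radial density is
O(exp(-α(d-1)t)) (`exists_radialDensity_le`), and n = exp(a R_n).

The square of the clique count is a sum over pairs of (m-1)-tuples. By the Mecke formula
(`lintegral_sum_embedding`) the disjoint pairs contribute exactly the squared mean, so the variance
is at most the expected number of overlapping pairs (`variance_tupleCount_le`). These fall into
finitely many overlap patterns, and each pattern is one integral over at most 2m-3 points
(`lintegral_pattern_le`).

In a pattern let A and B be the lowest vertices of the two cliques, with h(A) ≤ h(B). Every other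
vertex lies above the lowest vertex of a clique containing it; integrating it out costs O(exp(η
h(B))) (`lintegral_pattern_le_lmarginal`). What is left is a path B–p, B–A–p or B–z–A–p, where z is
a shared vertex, and it is integrated from the end B towards p. The accumulated power of exp(η h(B))
is distributed over u, h(A) and the decay exp(-(a-η) h(B)). This succeeds because the lower bound on
α says precisely that (m-1)η < a. Each path yields exp((a + (m-2)η) u), which is the claimed
exponent.

The factor exp(c₁ ω_n) is pure slack: ω_n is bounded below, so inserting it only changes the
constant. -/

/-! ### Spherical coordinates and the measure of spherical caps. -/

theorem direction_zero (n : ℕ) (θ : Fin (n + 1) → ℝ) :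
    direction (n + 2) θ 0 = Real.cos (θ 0) := by
  simp [direction]

theorem direction_succ (n : ℕ) (θ : Fin (n + 1) → ℝ) (j : Fin (n + 1)) :
    direction (n + 2) θ j.succ =
      Real.sin (θ 0) * direction (n + 1) (fun i : Fin n => θ i.succ) j := by
  change (∏ i : Fin (n + 1), if i.val < j.succ.val then Real.sin (θ i) else 1) *
      (if h : j.succ.val < n + 1 then Real.cos (θ ⟨j.succ.val, h⟩) else 1) =
    Real.sin (θ 0) * ((∏ i : Fin n, if i.val < j.val then Real.sin (θ i.succ) else 1) *
      (if h : j.val < n then Real.cos (θ (Fin.succ ⟨j.val, h⟩)) else 1))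
  rw [Fin.prod_univ_succ, ← mul_assoc]
  congr 1
  · simp
  · simp [Fin.succ]

theorem norm_direction (n : ℕ) (θ : Fin n → ℝ) : ‖direction (n + 1) θ‖ = 1 := by
  suffices h : ‖direction (n + 1) θ‖ ^ 2 = 1 by
    exact (pow_eq_one_iff_of_nonneg (norm_nonneg _) two_ne_zero).1 h
  induction n with
  | zero =>
    rw [EuclideanSpace.norm_sq_eq]
    simp [direction]
  | succ n ih =>
    rw [EuclideanSpace.norm_sq_eq, Fin.sum_univ_succ, direction_zero]
    have := ih (fun i => θ i.succ)
    rw [EuclideanSpace.norm_sq_eq] at this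
    simp only [direction_succ, norm_mul, mul_pow, ← Finset.mul_sum]
    rw [this]
    simp

/-- Splitting off the first coordinate expresses a chord through one of a sphere of one dimension
less, scaled by sines; this drives the induction on the dimension. -/
theorem norm_direction_sub_sq (n : ℕ) (θ θ' : Fin (n + 1) → ℝ) :
    ‖direction (n + 2) θ - direction (n + 2) θ'‖ ^ 2 =
      (Real.cos (θ 0) - Real.cos (θ' 0)) ^ 2 +
      ‖Real.sin (θ 0) • direction (n + 1) (fun i : Fin n => θ i.succ) -
        Real.sin (θ' 0) • direction (n + 1) (fun i : Fin n => θ' i.succ)‖ ^ 2 := by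
  rw [EuclideanSpace.norm_sq_eq, EuclideanSpace.norm_sq_eq, Fin.sum_univ_succ]
  simp [direction_zero, direction_succ]

theorem chord_sq (x y : ℝ) :
    (Real.cos x - Real.cos y) ^ 2 + (Real.sin x - Real.sin y) ^ 2 =
      (2 * Real.sin ((x - y) / 2)) ^ 2 := by
  have h : Real.cos (x - y) = 1 - 2 * Real.sin ((x - y) / 2) ^ 2 := by
    have := Real.cos_sq' ((x - y) / 2)
    have h2 := Real.cos_two_mul ((x - y) / 2)
    rw [show 2 * ((x - y) / 2) = x - y by ring] at h2
    linarith
  rw [Real.cos_sub] at h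
  nlinarith [Real.sin_sq_add_cos_sq x, Real.sin_sq_add_cos_sq y]

/-- An arc of length at most `π` is at most `π / 2` times as long as its chord. -/
theorem abs_sub_le_of_chord_le {x y r : ℝ} (hxy : |x - y| ≤ Real.pi) (hr : 0 ≤ r)
    (h : (Real.cos x - Real.cos y) ^ 2 + (Real.sin x - Real.sin y) ^ 2 ≤ r ^ 2) :
    |x - y| ≤ Real.pi / 2 * r := by
  rw [chord_sq] at h
  have h1 : |2 * Real.sin ((x - y) / 2)| ≤ r := abs_le_of_sq_le_sq h hr
  have h2 : Real.sin (|x - y| / 2) = |Real.sin ((x - y) / 2)| := by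
    rcases abs_cases (x - y) with ⟨ha, _⟩ | ⟨ha, _⟩
    · rw [ha, abs_of_nonneg]
      exact Real.sin_nonneg_of_nonneg_of_le_pi (by linarith) (by linarith)
    · rw [ha, neg_div, Real.sin_neg, abs_of_nonpos]
      exact Real.sin_nonpos_of_nonpos_of_neg_pi_le (by linarith) (by linarith)
  have h3 := Real.mul_le_sin (x := |x - y| / 2) (by positivity) (by linarith)
  have h4 : |Real.sin ((x - y) / 2)| ≤ r / 2 := by
    rw [abs_mul, abs_two] at h1; linarith
  have hpi := Real.pi_pos
  have h5 : 2 / Real.pi * (|x - y| / 2) ≤ r / 2 := by linarith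
  have h6 : 2 / Real.pi * (|x - y| / 2) = |x - y| / Real.pi := by ring
  rw [h6, div_le_iff₀ hpi] at h5
  linarith

/-- Reverse triangle inequality for the last coordinates, whose norms are the two sines. -/
theorem chord_le_norm_direction_sub (n : ℕ) (θ θ' : Fin (n + 1) → ℝ)
    (h : 0 ≤ Real.sin (θ 0)) (h' : 0 ≤ Real.sin (θ' 0)) :
    (Real.cos (θ 0) - Real.cos (θ' 0)) ^ 2 + (Real.sin (θ 0) - Real.sin (θ' 0)) ^ 2 ≤
      ‖direction (n + 2) θ - direction (n + 2) θ'‖ ^ 2 := by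
  rw [norm_direction_sub_sq]
  refine add_le_add le_rfl ?_
  rw [sq_le_sq, abs_norm]
  have := abs_norm_sub_norm_le (Real.sin (θ 0) • direction (n + 1) (fun i : Fin n => θ i.succ))
    (Real.sin (θ' 0) • direction (n + 1) (fun i : Fin n => θ' i.succ))
  rwa [norm_smul, norm_smul, norm_direction, norm_direction, Real.norm_of_nonneg h,
    Real.norm_of_nonneg h', mul_one, mul_one] at this

/-- Replacing sin θ₀ • b by sin θ'₀ • b produces an error that is itself bounded by the chord, hence
the factor 2. -/
theorem sin_mul_norm_direction_sub_le (n : ℕ) (θ θ' : Fin (n + 1) → ℝ)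
    (h : 0 ≤ Real.sin (θ 0)) (h' : 0 ≤ Real.sin (θ' 0)) {r : ℝ} (hr : 0 ≤ r)
    (hd : ‖direction (n + 2) θ - direction (n + 2) θ'‖ ≤ r) :
    Real.sin (θ 0) * ‖direction (n + 1) (fun i : Fin n => θ i.succ) -
      direction (n + 1) (fun i : Fin n => θ' i.succ)‖ ≤ 2 * r := by
  have h1 := chord_le_norm_direction_sub n θ θ' h h'
  have h2 := norm_direction_sub_sq n θ θ'
  set a := direction (n + 1) (fun i : Fin n => θ i.succ)
  set b := direction (n + 1) (fun i : Fin n => θ' i.succ)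
  have hb : ‖b‖ = 1 := norm_direction _ _
  have hd2 : ‖direction (n + 2) θ - direction (n + 2) θ'‖ ^ 2 ≤ r ^ 2 := by gcongr
  have h3 : |Real.sin (θ' 0) - Real.sin (θ 0)| ≤ r :=
    abs_le_of_sq_le_sq' (by nlinarith [sq_nonneg (Real.cos (θ 0) - Real.cos (θ' 0))]) hr |> abs_le.2
  have h4 : ‖Real.sin (θ 0) • a - Real.sin (θ' 0) • b‖ ≤ r :=
    (pow_le_pow_iff_left₀ (norm_nonneg _) hr two_ne_zero).1
      (by nlinarith [sq_nonneg (Real.cos (θ 0) - Real.cos (θ' 0))])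
  calc Real.sin (θ 0) * ‖a - b‖ = ‖Real.sin (θ 0) • (a - b)‖ := by
        rw [norm_smul, Real.norm_of_nonneg h]
    _ = ‖(Real.sin (θ 0) • a - Real.sin (θ' 0) • b) + (Real.sin (θ' 0) - Real.sin (θ 0)) • b‖ := by
        congr 1; module
    _ ≤ r + r := by
        refine (norm_add_le _ _).trans (add_le_add h4 ?_)
        rw [norm_smul, hb, mul_one]; exact h3
    _ = 2 * r := by ring

theorem continuous_direction (n : ℕ) : Continuous (direction (n + 1)) := by
  unfold direction
  refine (PiLp.continuous_toLp 2 _).comp (continuous_pi fun j => ?_)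
  refine Continuous.mul (continuous_finsetProd _ fun i _ => ?_) ?_
  · split_ifs <;> fun_prop
  · split_ifs <;> fun_prop

theorem measurableSet_angles (d : ℕ) : MeasurableSet (angles d) := by
  unfold angles
  simp only [Set.ofPred_forall]
  refine MeasurableSet.iInter fun i => ?_
  by_cases h : i.val + 2 < d <;> simp only [h, if_true, if_false]
  · exact (measurableSet_le measurable_const (measurable_pi_apply i)).inter
      (measurableSet_le (measurable_pi_apply i) measurable_const)
  · exact (measurableSet_le measurable_const (measurable_pi_apply i)).inter
      (measurableSet_lt (measurable_pi_apply i) measurable_const)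

/-- The density of the angles of a point of the sphere in `ℝ^(n + 1)`, up to normalization. -/
noncomputable def sineWeight (n : ℕ) (θ : Fin n → ℝ) : ℝ :=
  ∏ i : Fin n, Real.sin (θ i) ^ (n - 1 - i.val)

theorem sineWeight_succ (n : ℕ) (θ : Fin (n + 1) → ℝ) :
    sineWeight (n + 1) θ = Real.sin (θ 0) ^ n * sineWeight n (fun i => θ i.succ) := by
  unfold sineWeight
  rw [Fin.prod_univ_succ]
  congr 1
  refine Finset.prod_congr rfl fun i _ => ?_
  congr 1
  simp only [Fin.val_succ]
  omega

theorem mem_angles_succ (n : ℕ) (θ : Fin (n + 2) → ℝ) :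
    θ ∈ angles (n + 3) ↔ (0 ≤ θ 0 ∧ θ 0 ≤ Real.pi) ∧ (fun i : Fin (n + 1) => θ i.succ) ∈ angles (n + 2) := by
  change (∀ i : Fin (n + 2), 0 ≤ θ i ∧ if i.val + 2 < n + 3 then _ else _) ↔
    _ ∧ ∀ i : Fin (n + 1), 0 ≤ θ i.succ ∧ if i.val + 2 < n + 2 then _ else _
  rw [Fin.forall_fin_succ]
  simp [show ∀ i : ℕ, (i + 1 + 2 < n + 3 ↔ i < n) by omega]

theorem lintegral_fin_cons {n : ℕ} (F : (Fin (n + 1) → ℝ) → ℝ≥0∞) (hF : Measurable F) :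
    ∫⁻ θ, F θ = ∫⁻ x : ℝ, ∫⁻ y : Fin n → ℝ, F (Fin.cons x y) := by
  have h := (volume_preserving_piFinSuccAbove (fun _ : Fin (n + 1) => ℝ) 0).symm
  rw [← h.lintegral_comp hF, Measure.volume_eq_prod]
  refine (lintegral_prod (μ := volume) (ν := volume)
    (fun z => F ((MeasurableEquiv.piFinSuccAbove (fun _ => ℝ) 0).symm z))
    (hF.comp h.measurable).aemeasurable).trans ?_
  refine lintegral_congr fun x => lintegral_congr fun y => congrArg F ?_
  change Fin.insertNth (α := fun _ => ℝ) 0 x y = Fin.cons x y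
  exact Fin.insertNth_zero' x y

theorem measurable_cap (n : ℕ) (θ' : Fin (n + 1) → ℝ) (r : ℝ) :
    Measurable ((angles (n + 2) ∩
      {θ | ‖direction (n + 2) θ - direction (n + 2) θ'‖ ≤ r}).indicator
        (fun θ => ENNReal.ofReal (sineWeight (n + 1) θ))) := by
  refine Measurable.indicator ?_ ((measurableSet_angles _).inter ?_)
  · unfold sineWeight
    fun_prop
  · exact measurableSet_le ((continuous_direction _).measurable.sub_const _).norm measurable_const

/-- A spherical cap of radius `r` has measure `O(r ^ (n + 1))` in the spherical angles. -/
theorem exists_lintegral_cap_le (n : ℕ) : ∃ C : ℝ, 0 < C ∧ ∀ θ' ∈ angles (n + 2), ∀ r : ℝ, 0 < r →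
    ∫⁻ θ : Fin (n + 1) → ℝ, (angles (n + 2) ∩
      {θ | ‖direction (n + 2) θ - direction (n + 2) θ'‖ ≤ r}).indicator
        (fun θ => ENNReal.ofReal (sineWeight (n + 1) θ)) θ ≤ ENNReal.ofReal (C * r ^ (n + 1)) := by
  have hpi := Real.pi_pos
  induction n with
  | zero =>
    refine ⟨3 * Real.pi, by positivity, fun θ' hθ' r hr => ?_⟩
    rw [lintegral_fin_cons _ (measurable_cap _ _ _)]
    -- On the circle, closeness only holds modulo 2π, so nearby angles lie in one of three
    -- intervals.
    set T : Set ℝ := Metric.closedBall (θ' 0) (Real.pi / 2 * r) ∪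
      (Metric.closedBall (θ' 0 + 2 * Real.pi) (Real.pi / 2 * r) ∪
        Metric.closedBall (θ' 0 - 2 * Real.pi) (Real.pi / 2 * r)) with hT
    have hTm : MeasurableSet T := Metric.isClosed_closedBall.measurableSet.union
      (Metric.isClosed_closedBall.measurableSet.union Metric.isClosed_closedBall.measurableSet)
    have key : ∀ (x : ℝ) (y : Fin 0 → ℝ), (angles (0 + 2) ∩
        {θ | ‖direction (0 + 2) θ - direction (0 + 2) θ'‖ ≤ r}).indicator
        (fun θ => ENNReal.ofReal (sineWeight (0 + 1) θ)) (Fin.cons x y) ≤ T.indicator 1 x := by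
      intro x y
      by_cases h : (Fin.cons x y : Fin 1 → ℝ) ∈ (angles (0 + 2) ∩
        {θ | ‖direction (0 + 2) θ - direction (0 + 2) θ'‖ ≤ r})
      swap
      · rw [Set.indicator_of_notMem h]; exact zero_le
      have hx : 0 ≤ x ∧ x < 2 * Real.pi := by simpa using h.1 0
      have hx' : 0 ≤ θ' 0 ∧ θ' 0 < 2 * Real.pi := by simpa using hθ' 0
      have hch : (Real.cos x - Real.cos (θ' 0)) ^ 2 + (Real.sin x - Real.sin (θ' 0)) ^ 2 ≤ r ^ 2 := by
        have h2 : ‖direction (0 + 2) (Fin.cons x y) - direction (0 + 2) θ'‖ ^ 2 ≤ r ^ 2 :=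
          pow_le_pow_left₀ (norm_nonneg _) h.2 2
        rw [norm_direction_sub_sq,
          Subsingleton.elim (fun i : Fin 0 => θ' i.succ)
            (fun i : Fin 0 => (Fin.cons x y : Fin 1 → ℝ) i.succ), ← sub_smul, norm_smul,
          norm_direction, mul_one, Real.norm_eq_abs, sq_abs] at h2
        exact h2
      have hxT : x ∈ T := by
        simp only [hT, Set.mem_union, Metric.mem_closedBall, Real.dist_eq]
        rcases le_or_gt |x - θ' 0| Real.pi with hc | hc
        · exact Or.inl (abs_sub_le_of_chord_le hc hr.le hch)
        · rcases lt_abs.1 hc with hc | hc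
          · refine Or.inr (Or.inl (abs_sub_le_of_chord_le ?_ hr.le ?_))
            · rw [abs_le]; constructor <;> linarith
            · simpa using hch
          · refine Or.inr (Or.inr (abs_sub_le_of_chord_le ?_ hr.le ?_))
            · rw [abs_le]; constructor <;> linarith
            · simpa using hch
      rw [Set.indicator_of_mem h, Set.indicator_of_mem hxT]
      simp [sineWeight]
    calc _ ≤ ∫⁻ x : ℝ, ∫⁻ _y : Fin 0 → ℝ, T.indicator 1 x :=
          lintegral_mono fun x => lintegral_mono fun y => key x y
      _ = volume T := by
          simp only [lintegral_const, volume_pi, Measure.pi_univ, Finset.univ_eq_empty,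
            Finset.prod_empty, mul_one]
          rw [lintegral_indicator_one hTm]
      _ ≤ ENNReal.ofReal (Real.pi * r) + (ENNReal.ofReal (Real.pi * r) +
            ENNReal.ofReal (Real.pi * r)) := by
          refine (measure_union_le _ _).trans (add_le_add ?_
            ((measure_union_le _ _).trans (add_le_add ?_ ?_)))
          all_goals
            rw [Real.volume_closedBall]
            exact ENNReal.ofReal_le_ofReal (by linarith)
      _ = _ := by
          rw [← ENNReal.ofReal_add (by positivity) (by positivity),
            ← ENNReal.ofReal_add (by positivity) (by positivity)]
          congr 1; ring
  | succ n ih =>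
    obtain ⟨C, hC, ih⟩ := ih
    refine ⟨Real.pi * C * 2 ^ (n + 1), by positivity, fun (θ' : Fin (n + 2) → ℝ) hθ' r hr => ?_⟩
    rw [lintegral_fin_cons _ (measurable_cap _ _ _)]
    have hθ2 := (mem_angles_succ n θ').1 hθ'
    have hs' : 0 ≤ Real.sin (θ' 0) := Real.sin_nonneg_of_nonneg_of_le_pi hθ2.1.1 hθ2.1.2
    set K : ℝ≥0∞ := ENNReal.ofReal (C * (2 * r) ^ (n + 1))
    have key : ∀ x : ℝ, ∫⁻ y : Fin (n + 1) → ℝ, (angles (n + 1 + 2) ∩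
        {θ | ‖direction (n + 1 + 2) θ - direction (n + 1 + 2) θ'‖ ≤ r}).indicator
        (fun θ => ENNReal.ofReal (sineWeight (n + 1 + 1) θ)) (Fin.cons x y) ≤
        (Metric.closedBall (θ' 0) (Real.pi / 2 * r)).indicator (fun _ => K) x := by
      intro x
      set B := (angles (n + 1 + 2) ∩
        {θ | ‖direction (n + 1 + 2) θ - direction (n + 1 + 2) θ'‖ ≤ r})
      by_cases hx0 : 0 ≤ x ∧ x ≤ Real.pi
      swap
      · rw [lintegral_eq_zero_of_ae_eq_zero]
        · exact zero_le
        · refine Filter.Eventually.of_forall fun y => ?_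
          have : (Fin.cons x y : Fin (n + 2) → ℝ) ∉ B := fun h =>
            hx0 ((mem_angles_succ n _).1 h.1).1
          exact Set.indicator_of_notMem this _
      have hs : 0 ≤ Real.sin x := Real.sin_nonneg_of_nonneg_of_le_pi hx0.1 hx0.2
      by_cases hxb : x ∈ Metric.closedBall (θ' 0) (Real.pi / 2 * r)
      swap
      · rw [lintegral_eq_zero_of_ae_eq_zero]
        · exact zero_le
        · refine Filter.Eventually.of_forall fun y => ?_
          have : (Fin.cons x y : Fin (n + 2) → ℝ) ∉ B := by
            intro h
            refine hxb ?_
            rw [Metric.mem_closedBall, Real.dist_eq]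
            refine abs_sub_le_of_chord_le (by rw [abs_le]; constructor <;> linarith [hθ2.1.1, hθ2.1.2])
              hr.le ?_
            exact (chord_le_norm_direction_sub (n + 1) (Fin.cons x y) θ' hs hs').trans
              (pow_le_pow_left₀ (norm_nonneg _) h.2 2)
          exact Set.indicator_of_notMem this _
      rw [Set.indicator_of_mem hxb]
      -- At the poles the weight vanishes. Elsewhere the remaining angles lie in a cap of radius 2r
      -- / sin x, and the weight sin^(n+1) x cancels the power of sin x in its measure.
      rcases hs.eq_or_lt with hs0 | hs0
      · rw [lintegral_eq_zero_of_ae_eq_zero]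
        · exact zero_le
        · refine Filter.Eventually.of_forall fun y => ?_
          by_cases h : (Fin.cons x y : Fin (n + 2) → ℝ) ∈ B
          · refine (Set.indicator_of_mem h _).trans ?_
            rw [sineWeight_succ]
            simp [← hs0]
          · exact Set.indicator_of_notMem h _
      calc _ ≤ ∫⁻ y : Fin (n + 1) → ℝ, ENNReal.ofReal (Real.sin x ^ (n + 1)) * (angles (n + 2) ∩
            {θ | ‖direction (n + 2) θ - direction (n + 2) (fun i => θ' i.succ)‖ ≤
              2 * r / Real.sin x}).indicator
            (fun θ => ENNReal.ofReal (sineWeight (n + 1) θ)) y := by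
            refine lintegral_mono fun y => ?_
            by_cases h : (Fin.cons x y : Fin (n + 2) → ℝ) ∈ B
            · have h2 := sin_mul_norm_direction_sub_le (n + 1) (Fin.cons x y) θ' hs hs' hr.le h.2
              rw [Set.indicator_of_mem h, Set.indicator_of_mem, sineWeight_succ,
                ENNReal.ofReal_mul (by simpa using pow_nonneg hs _)]
              · simp
              · refine ⟨((mem_angles_succ n _).1 h.1).2, ?_⟩
                rw [Set.mem_ofPred_eq, le_div_iff₀ hs0, mul_comm]
                exact h2
            · rw [Set.indicator_of_notMem h]; exact zero_le
        _ ≤ ENNReal.ofReal (Real.sin x ^ (n + 1)) *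
              ENNReal.ofReal (C * (2 * r / Real.sin x) ^ (n + 1)) := by
            exact (lintegral_const_mul _ (measurable_cap n (fun i => θ' i.succ)
              (2 * r / Real.sin x))).le.trans (mul_le_mul' le_rfl (ih _ hθ2.2 _ (by positivity)))
        _ = K := by
            rw [← ENNReal.ofReal_mul (by positivity)]
            congr 1
            rw [div_pow]
            field_simp
    calc _ ≤ ∫⁻ x : ℝ, (Metric.closedBall (θ' 0) (Real.pi / 2 * r)).indicator (fun _ => K) x :=
          lintegral_mono key
      _ = K * ENNReal.ofReal (2 * (Real.pi / 2 * r)) := by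
          rw [lintegral_indicator_const Metric.isClosed_closedBall.measurableSet,
            Real.volume_closedBall]
      _ = _ := by
          rw [← ENNReal.ofReal_mul (by positivity)]
          congr 1; ring

/-! ### The hyperbolic distance in polar coordinates. -/

theorem cosh_dH {d : ℕ} {x y : EuclideanSpace ℝ (Fin d)} (hx : ‖x‖ < 1) (hy : ‖y‖ < 1) :
    Real.cosh (dH x y) = 1 + 2 * ‖x - y‖ ^ 2 / ((1 - ‖x‖ ^ 2) * (1 - ‖y‖ ^ 2)) := by
  have hx2 : 0 < 1 - ‖x‖ ^ 2 := by nlinarith [norm_nonneg x]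
  have hy2 : 0 < 1 - ‖y‖ ^ 2 := by nlinarith [norm_nonneg y]
  refine Real.cosh_arcosh ?_
  have : 0 ≤ 2 * ‖x - y‖ ^ 2 / ((1 - ‖x‖ ^ 2) * (1 - ‖y‖ ^ 2)) := by positivity
  linarith

theorem dH_nonneg {d : ℕ} {x y : EuclideanSpace ℝ (Fin d)} (hx : ‖x‖ < 1) (hy : ‖y‖ < 1) :
    0 ≤ dH x y := by
  have hx2 : 0 < 1 - ‖x‖ ^ 2 := by nlinarith [norm_nonneg x]
  have hy2 : 0 < 1 - ‖y‖ ^ 2 := by nlinarith [norm_nonneg y]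
  refine Real.arcosh_nonneg ?_
  have : 0 ≤ 2 * ‖x - y‖ ^ 2 / ((1 - ‖x‖ ^ 2) * (1 - ‖y‖ ^ 2)) := by positivity
  linarith

theorem measurable_dH (d : ℕ) :
    Measurable fun z : EuclideanSpace ℝ (Fin d) × EuclideanSpace ℝ (Fin d) => dH z.1 z.2 := by
  unfold dH Real.arcosh
  fun_prop

theorem measurable_dH_left {d : ℕ} (w : EuclideanSpace ℝ (Fin d)) :
    Measurable fun x : EuclideanSpace ℝ (Fin d) => dH x w :=
  (measurable_dH d).comp (f := fun x => (x, w)) (measurable_id.prodMk measurable_const)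

theorem measurable_dH_right {d : ℕ} (w : EuclideanSpace ℝ (Fin d)) :
    Measurable fun x : EuclideanSpace ℝ (Fin d) => dH w x :=
  (measurable_dH d).comp (f := fun x => (w, x)) (measurable_const.prodMk measurable_id)

theorem norm_tanh_smul {d : ℕ} {a : ℝ} (ha : 0 ≤ a) {e : EuclideanSpace ℝ (Fin d)} (he : ‖e‖ = 1) :
    ‖Real.tanh (a / 2) • e‖ = Real.tanh (a / 2) := by
  rw [norm_smul, he, mul_one, Real.norm_of_nonneg]
  rw [Real.tanh_eq_sinh_div_cosh]
  exact div_nonneg (Real.sinh_nonneg_iff.2 (by linarith)) (Real.cosh_pos _).le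

theorem dH_zero_tanh_smul {d : ℕ} {a : ℝ} (ha : 0 ≤ a) {e : EuclideanSpace ℝ (Fin d)}
    (he : ‖e‖ = 1) : dH 0 (Real.tanh (a / 2) • e) = a := by
  unfold dH
  rw [zero_sub, norm_neg, norm_tanh_smul ha he, norm_zero]
  refine Eq.trans (congrArg Real.arcosh ?_) (Real.arcosh_cosh ha)
  have hc := Real.cosh_pos (a / 2)
  have h1 := Real.cosh_sq (a / 2)
  have h2 : Real.cosh a = 1 + 2 * Real.sinh (a / 2) ^ 2 := by
    have := Real.cosh_two_mul (a / 2)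
    rw [show 2 * (a / 2) = a by ring] at this
    linarith
  have h3 : 1 - Real.tanh (a / 2) ^ 2 = 1 / Real.cosh (a / 2) ^ 2 := by
    rw [Real.tanh_eq_sinh_div_cosh]
    field_simp
    linarith
  rw [h2, show (1 - (0:ℝ) ^ 2) = 1 by norm_num, one_mul, h3, Real.tanh_eq_sinh_div_cosh]
  field_simp

/-- Every point of the unit ball has hyperbolic polar coordinates. -/
theorem exists_eq_tanh_smul {d : ℕ} (hd : 1 ≤ d) {x : EuclideanSpace ℝ (Fin d)} (hx : ‖x‖ < 1) :
    ∃ e, ‖e‖ = 1 ∧ x = Real.tanh (dH 0 x / 2) • e := by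
  have key : ∀ e : EuclideanSpace ℝ (Fin d), ‖e‖ = 1 → x = ‖x‖ • e → 
      ∃ e, ‖e‖ = 1 ∧ x = Real.tanh (dH 0 x / 2) • e := by
    intro e he hxe
    have h1 : ‖x‖ = Real.tanh (2 * Real.artanh ‖x‖ / 2) := by
      rw [mul_div_cancel_left₀ _ two_ne_zero, Real.tanh_artanh]
      exact ⟨by linarith [norm_nonneg x], hx⟩
    have h0 : 0 ≤ 2 * Real.artanh ‖x‖ := by
      have := Real.artanh_nonneg (norm_nonneg x)
      linarith
    refine ⟨e, he, ?_⟩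
    have h2 : dH 0 x = 2 * Real.artanh ‖x‖ := by
      conv_lhs => rw [hxe, h1]
      exact dH_zero_tanh_smul h0 he
    rw [h2, ← h1]; exact hxe
  by_cases h : x = 0
  -- At the origin any unit vector serves as the direction.
  · obtain ⟨n, rfl⟩ := Nat.exists_eq_add_of_le' hd
    exact key (direction (n + 1) 0) (norm_direction _ _) (by simp [h])
  · refine key (‖x‖⁻¹ • x) ?_ ?_
    · rw [norm_smul, norm_inv, norm_norm, inv_mul_cancel₀ (norm_ne_zero_iff.2 h)]
    · rw [smul_smul, mul_inv_cancel₀ (norm_ne_zero_iff.2 h), one_smul]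

/-- The hyperbolic law of cosines reads cosh d = cosh(a-b) + sinh a sinh b |e-e'|²/2; only the last
term is kept. -/
theorem sinh_mul_sinh_mul_norm_sub_sq_le {d : ℕ} {a b R : ℝ} (ha : 0 ≤ a) (hb : 0 ≤ b)
    {e e' : EuclideanSpace ℝ (Fin d)} (he : ‖e‖ = 1) (he' : ‖e'‖ = 1)
    (h : dH (Real.tanh (a / 2) • e) (Real.tanh (b / 2) • e') ≤ R) :
    Real.sinh a * Real.sinh b * ‖e - e'‖ ^ 2 ≤ 2 * Real.cosh R := by
  have lt1 : ∀ a : ℝ, Real.tanh (a / 2) < 1 := fun a => Real.tanh_lt_one _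
  have hx := norm_tanh_smul ha he
  have hy := norm_tanh_smul hb he'
  have hxl := hx.trans_lt (lt1 a)
  have hyl := hy.trans_lt (lt1 b)
  have h1 := cosh_dH hxl hyl
  have h0 := dH_nonneg hxl hyl
  have h2 : Real.cosh (dH (Real.tanh (a / 2) • e) (Real.tanh (b / 2) • e')) ≤ Real.cosh R :=
    Real.cosh_le_cosh.2 (by rwa [abs_of_nonneg h0, abs_of_nonneg (h0.trans h)])
  rw [h1, hx, hy] at h2
  have hn : ‖Real.tanh (a / 2) • e - Real.tanh (b / 2) • e'‖ ^ 2 =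
      (Real.tanh (a / 2) - Real.tanh (b / 2)) ^ 2 +
        Real.tanh (a / 2) * Real.tanh (b / 2) * ‖e - e'‖ ^ 2 := by
    rw [@norm_sub_sq_real, @norm_sub_sq_real, norm_smul, norm_smul, he, he', inner_smul_left,
      inner_smul_right]
    simp only [Real.norm_eq_abs, mul_one, sq_abs, RCLike.conj_to_real]
    ring
  have hs : ∀ a : ℝ, 2 * Real.tanh (a / 2) = Real.sinh a * (1 - Real.tanh (a / 2) ^ 2) := by
    intro a
    have hc := Real.cosh_pos (a / 2)
    have h1 := Real.cosh_sq (a / 2)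
    have h2 : Real.sinh a = 2 * Real.sinh (a / 2) * Real.cosh (a / 2) := by
      have := Real.sinh_two_mul (a / 2)
      rwa [show 2 * (a / 2) = a by ring] at this
    rw [h2, Real.tanh_eq_sinh_div_cosh]
    field_simp
    rw [h1]; ring
  have hpa : 0 < 1 - Real.tanh (a / 2) ^ 2 := by
    rw [← hx]; nlinarith [norm_nonneg (Real.tanh (a / 2) • e)]
  have hpb : 0 < 1 - Real.tanh (b / 2) ^ 2 := by
    rw [← hy]; nlinarith [norm_nonneg (Real.tanh (b / 2) • e')]
  have h3 : Real.sinh a * Real.sinh b * ‖e - e'‖ ^ 2 / 2 ≤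
      2 * ‖Real.tanh (a / 2) • e - Real.tanh (b / 2) • e'‖ ^ 2 /
        ((1 - Real.tanh (a / 2) ^ 2) * (1 - Real.tanh (b / 2) ^ 2)) := by
    rw [le_div_iff₀ (by positivity), hn]
    have := hs a
    have := hs b
    calc _ = (Real.sinh a * (1 - Real.tanh (a / 2) ^ 2)) * (Real.sinh b * (1 - Real.tanh (b / 2) ^ 2)) *
          ‖e - e'‖ ^ 2 / 2 := by ring
      _ = 2 * (Real.tanh (a / 2) * Real.tanh (b / 2) * ‖e - e'‖ ^ 2) := by
          rw [← hs a, ← hs b]; ring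
      _ ≤ _ := by nlinarith [sq_nonneg (Real.tanh (a / 2) - Real.tanh (b / 2))]
  linarith

theorem exp_div_four_le_sinh {a : ℝ} (ha : 1 ≤ a) : Real.exp a / 4 ≤ Real.sinh a := by
  rw [Real.sinh_eq]
  have h1 : Real.exp (-a) ≤ 1 := Real.exp_le_one_iff.2 (by linarith)
  have h2 := Real.add_one_le_exp a
  linarith

/-- Two adjacent vertices at distances `a, b` from the origin enclose an angle
`O(exp ((R - a - b) / 2))`. -/
theorem norm_sub_le_of_dH_le {d : ℕ} {a b R : ℝ} (ha : 0 ≤ a) (hb : 0 ≤ b) (haR : a ≤ R)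
    (hbR : b ≤ R) {e e' : EuclideanSpace ℝ (Fin d)} (he : ‖e‖ = 1) (he' : ‖e'‖ = 1)
    (h : dH (Real.tanh (a / 2) • e) (Real.tanh (b / 2) • e') ≤ R) :
    ‖e - e'‖ ≤ 12 * Real.exp ((R - a - b) / 2) := by
  by_cases hab : 1 ≤ a ∧ 1 ≤ b
  · have h1 := sinh_mul_sinh_mul_norm_sub_sq_le ha hb he he' h
    have h2 : Real.exp a / 4 * (Real.exp b / 4) ≤ Real.sinh a * Real.sinh b := by
      exact mul_le_mul (exp_div_four_le_sinh hab.1) (exp_div_four_le_sinh hab.2) (by positivity)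
        (Real.sinh_nonneg_iff.2 ha)
    have h3 : Real.cosh R ≤ Real.exp R := by
      rw [Real.cosh_eq]
      have : Real.exp (-R) ≤ Real.exp R := Real.exp_le_exp.2 (by linarith)
      linarith
    have h4 : Real.exp a / 4 * (Real.exp b / 4) * ‖e - e'‖ ^ 2 ≤ 2 * Real.exp R := by
      have := mul_le_mul_of_nonneg_right h2 (sq_nonneg ‖e - e'‖)
      linarith
    have h5 : Real.exp R = Real.exp a * Real.exp b * Real.exp ((R - a - b) / 2) ^ 2 := by
      rw [← Real.exp_nat_mul, ← Real.exp_add, ← Real.exp_add]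
      congr 1; push_cast; ring
    have hab' : 0 < Real.exp a * Real.exp b := by positivity
    have h6 : ‖e - e'‖ ^ 2 ≤ 32 * Real.exp ((R - a - b) / 2) ^ 2 := by
      rw [h5] at h4
      refine le_of_mul_le_mul_left ?_ hab'
      nlinarith
    refine (pow_le_pow_iff_left₀ (norm_nonneg _) (by positivity) two_ne_zero).1 ?_
    rw [mul_pow]
    nlinarith [sq_nonneg (Real.exp ((R - a - b) / 2))]
  · have h1 : ‖e - e'‖ ≤ 2 := (norm_sub_le _ _).trans (by rw [he, he']; norm_num)
    -- If one of a, b is below 1, the other being at most R keeps the exponent above -1/2, and the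
    -- trivial bound |e - e'| ≤ 2 suffices.
    have h2 : -1 ≤ R - a - b := by
      by_contra hc
      exact hab ⟨by linarith, by linarith⟩
    have h3 := Real.add_one_le_exp ((R - a - b) / 2)
    linarith

theorem dH_zero_polarPoint {n : ℕ} {R t : ℝ} (ht : t ≤ R) (θ : Fin n → ℝ) :
    dH 0 (polarPoint (n + 1) R (t, θ)) = R - t :=
  dH_zero_tanh_smul (by simpa using ht) (norm_direction _ _)

theorem norm_polarPoint_lt {n : ℕ} {R t : ℝ} (ht : t ≤ R) (θ : Fin n → ℝ) :
    ‖polarPoint (n + 1) R (t, θ)‖ < 1 :=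
  (norm_tanh_smul (sub_nonneg.2 ht) (norm_direction n θ)).trans_lt (Real.tanh_lt_one _)

theorem continuous_polarPoint (n : ℕ) (R : ℝ) : Continuous (polarPoint (n + 1) R) := by
  unfold polarPoint
  have h : Continuous fun x : ℝ × (Fin (n + 1 - 1) → ℝ) => direction (n + 1) x.2 :=
    (continuous_direction n).comp continuous_snd
  refine Continuous.smul (f := fun x : ℝ × (Fin (n + 1 - 1) → ℝ) => Real.tanh ((R - x.1) / 2)) ?_ h
  simp only [Real.tanh_eq_sinh_div_cosh]
  exact Continuous.div (by fun_prop) (by fun_prop) fun x => (Real.cosh_pos _).ne'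

/-! ### The law of a vertex and the mass of its neighbourhoods. -/

theorem angularDensity_eq (n : ℕ) : ∃ Z : ℝ, 0 < Z ∧ ∀ θ : Fin (n + 1) → ℝ,
    angularDensity (n + 2) θ = sineWeight (n + 1) θ / Z :=
  ⟨2 * ∏ i : Fin (n + 1), ∫ s in (0 : ℝ)..Real.pi, Real.sin s ^ (n - i.val),
    mul_pos two_pos (Finset.prod_pos fun _ _ => integral_sin_pow_pos _), fun _ => rfl⟩

/-- The centre `e` is arbitrary: a nonempty cap is contained in one of twice the radius around one
of its own points, so surjectivity of the spherical coordinates is not needed. -/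
theorem exists_angularLaw_cap_le (n : ℕ) : ∃ C : ℝ, 0 < C ∧
    ∀ (e : EuclideanSpace ℝ (Fin (n + 2))) (r : ℝ), 0 < r →
      angularLaw (n + 2) {θ | ‖direction (n + 2) θ - e‖ ≤ r} ≤ ENNReal.ofReal (C * r ^ (n + 1)) := by
  obtain ⟨C, hC, h⟩ := exists_lintegral_cap_le n
  obtain ⟨Z, hZ, hZd⟩ := angularDensity_eq n
  refine ⟨C / Z * 2 ^ (n + 1), by positivity, fun e r hr => ?_⟩
  have hS : MeasurableSet {θ : Fin (n + 2 - 1) → ℝ | ‖direction (n + 2) θ - e‖ ≤ r} :=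
    measurableSet_le ((continuous_direction _).measurable.sub_const _).norm measurable_const
  unfold angularLaw
  rw [withDensity_apply _ hS, Measure.restrict_restrict hS]
  by_cases hne : ({θ : Fin (n + 2 - 1) → ℝ | ‖direction (n + 2) θ - e‖ ≤ r} ∩ angles (n + 2)).Nonempty
  swap
  · rw [Set.not_nonempty_iff_eq_empty.1 hne]
    simp
  obtain ⟨θ', h1, h2⟩ := hne
  rw [← lintegral_indicator (hS.inter (measurableSet_angles _))]
  calc _ ≤ ∫⁻ θ : Fin (n + 2 - 1) → ℝ, ENNReal.ofReal Z⁻¹ * (angles (n + 2) ∩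
      {θ | ‖direction (n + 2) θ - direction (n + 2) θ'‖ ≤ 2 * r}).indicator
        (fun θ => ENNReal.ofReal (sineWeight (n + 1) θ)) θ := by
        refine lintegral_mono fun θ => ?_
        by_cases hθ : θ ∈ ({θ : Fin (n + 2 - 1) → ℝ | ‖direction (n + 2) θ - e‖ ≤ r} ∩ angles (n + 2))
        · have : θ ∈ (angles (n + 2) ∩
              {θ | ‖direction (n + 2) θ - direction (n + 2) θ'‖ ≤ 2 * r}) := by
            refine ⟨hθ.2, ?_⟩
            rw [Set.mem_ofPred_eq] at h1 ⊢
            have h3 : ‖direction (n + 2) θ - e‖ ≤ r := hθ.1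
            have := norm_sub_le (direction (n + 2) θ - e) (direction (n + 2) θ' - e)
            rw [sub_sub_sub_cancel_right] at this
            linarith
          rw [Set.indicator_of_mem hθ, Set.indicator_of_mem this,
            ← ENNReal.ofReal_mul (by positivity), hZd, div_eq_inv_mul]
        · rw [Set.indicator_of_notMem hθ]; exact zero_le
    _ ≤ ENNReal.ofReal Z⁻¹ * ENNReal.ofReal (C * (2 * r) ^ (n + 1)) :=
        (lintegral_const_mul _ (measurable_cap n θ' (2 * r))).le.trans
          (mul_le_mul' le_rfl (h θ' h2 _ (by positivity)))
    _ = _ := by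
        rw [← ENNReal.ofReal_mul (by positivity)]
        congr 1; ring

/-- Numerator and denominator are both compared with powers of exp(αR), which cancel. The lower
bound `R₀` keeps the constant uniform in `R`. -/
theorem exists_radialDensity_le (n : ℕ) {α R₀ : ℝ} (hα : 0 < α) (hR₀ : 0 < R₀) :
    ∃ C : ℝ, 0 < C ∧ ∀ R, R₀ ≤ R → ∀ t, 0 ≤ t → t ≤ R →
      radialDensity (n + 2) α R t ≤ C * Real.exp (-(α * (n + 1) * t)) := by
  -- The ratio sinh/exp is increasing, so its value at R₀/2 is the worst one on the range of
  -- integration used for the denominator, the last stretch of length R₀/2.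
  set κ : ℝ := Real.sinh (α * (R₀ / 2)) / Real.exp (α * (R₀ / 2)) with hκ
  have hs0 : 0 < Real.sinh (α * (R₀ / 2)) := Real.sinh_pos_iff.2 (by positivity)
  have hκ0 : 0 < κ := by positivity
  have hκs : ∀ s, R₀ / 2 ≤ s → κ * Real.exp (α * s) ≤ Real.sinh (α * s) := by
    intro s hs
    rw [hκ, div_mul_eq_mul_div, div_le_iff₀ (by positivity), Real.sinh_eq, Real.sinh_eq]
    have h1 : Real.exp (-(α * s)) ≤ Real.exp (-(α * (R₀ / 2))) := Real.exp_le_exp.2 (by nlinarith)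
    have h2 : Real.exp (α * (R₀ / 2)) ≤ Real.exp (α * s) := Real.exp_le_exp.2 (by nlinarith)
    have h3 := mul_le_mul h1 h2 (by positivity) (by positivity)
    have h4 : 0 < Real.exp (-(α * (R₀ / 2))) := by positivity
    nlinarith
  have hden : ∀ R, R₀ ≤ R → R₀ / 2 * (κ * Real.exp (α * (R - R₀ / 2))) ^ (n + 1) ≤
      ∫ s in (0 : ℝ)..R, Real.sinh (α * s) ^ (n + 1) := by
    intro R hR
    have hint : ∀ a b : ℝ, IntervalIntegrable (fun s => Real.sinh (α * s) ^ (n + 1)) volume a b :=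
      fun a b => Continuous.intervalIntegrable (by fun_prop) _ _
    rw [← intervalIntegral.integral_add_adjacent_intervals (hint 0 (R - R₀ / 2)) (hint _ R)]
    have h1 : 0 ≤ ∫ s in (0 : ℝ)..(R - R₀ / 2), Real.sinh (α * s) ^ (n + 1) :=
      intervalIntegral.integral_nonneg (by linarith) fun s hs =>
        pow_nonneg (Real.sinh_nonneg_iff.2 (mul_nonneg hα.le hs.1)) _
    have h2 : ∫ s in (R - R₀ / 2)..R, (κ * Real.exp (α * (R - R₀ / 2))) ^ (n + 1) ≤
        ∫ s in (R - R₀ / 2)..R, Real.sinh (α * s) ^ (n + 1) := by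
      refine intervalIntegral.integral_mono_on (by linarith) (by simp) (hint _ _) fun s hs => ?_
      refine pow_le_pow_left₀ (by positivity) ?_ _
      refine le_trans ?_ (hκs s (by linarith [hs.1]))
      gcongr
      exact hs.1
    rw [intervalIntegral.integral_const, smul_eq_mul, sub_sub_cancel] at h2
    linarith
  refine ⟨1 / (R₀ / 2 * (κ * Real.exp (-(α * (R₀ / 2)))) ^ (n + 1)), by positivity,
    fun R hR t ht htR => ?_⟩
  have hd := hden R hR
  have hnum : Real.sinh (α * (R - t)) ^ (n + 1) ≤ Real.exp (α * (R - t)) ^ (n + 1) := by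
    refine pow_le_pow_left₀ (Real.sinh_nonneg_iff.2 (mul_nonneg hα.le (by linarith))) ?_ _
    rw [Real.sinh_eq]
    have := Real.exp_pos (α * (R - t))
    have := Real.exp_pos (-(α * (R - t)))
    linarith
  calc radialDensity (n + 2) α R t
      ≤ Real.exp (α * (R - t)) ^ (n + 1) /
          (R₀ / 2 * (κ * Real.exp (α * (R - R₀ / 2))) ^ (n + 1)) :=
        div_le_div₀ (by positivity) hnum (by positivity) hd
    _ = _ := by
        have e1 : Real.exp (α * (R - t)) = Real.exp (α * R) * Real.exp (-(α * t)) := by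
          rw [← Real.exp_add]; congr 1; ring
        have e2 : Real.exp (α * (R - R₀ / 2)) = Real.exp (α * R) * Real.exp (-(α * (R₀ / 2))) := by
          rw [← Real.exp_add]; congr 1; ring
        have e3 : Real.exp (-(α * (n + 1) * t)) = Real.exp (-(α * t)) ^ (n + 1) := by
          rw [← Real.exp_nat_mul]; congr 1; push_cast; ring
        rw [e1, e2, e3, mul_pow, mul_pow, mul_pow, mul_pow]
        field_simp

instance (d : ℕ) (α R : ℝ) : SFinite (radialLaw d α R) := by unfold radialLaw; infer_instance

instance (d : ℕ) : SFinite (angularLaw d) := by unfold angularLaw; infer_instance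

theorem measurable_radialDensity (d : ℕ) (α R : ℝ) :
    Measurable fun t => ENNReal.ofReal (radialDensity d α R t) := by
  unfold radialDensity
  have : Measurable fun t : ℝ => Real.sinh (α * (R - t)) := Continuous.measurable (by fun_prop)
  fun_prop

theorem lintegral_vertexLaw (n : ℕ) (α R : ℝ) (G : EuclideanSpace ℝ (Fin (n + 2)) → ℝ≥0∞)
    (hG : Measurable G) :
    ∫⁻ x, G x ∂vertexLaw (n + 2) α R = ∫⁻ t in Set.Icc 0 R,
      ENNReal.ofReal (radialDensity (n + 2) α R t) *
        ∫⁻ θ, G (polarPoint (n + 2) R (t, θ)) ∂angularLaw (n + 2) := by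
  have hm : Measurable fun z => G (polarPoint (n + 2) R z) :=
    hG.comp (continuous_polarPoint (n + 1) R).measurable
  unfold vertexLaw
  rw [lintegral_map hG (continuous_polarPoint (n + 1) R).measurable,
    lintegral_prod _ hm.aemeasurable]
  unfold radialLaw
  rw [lintegral_withDensity_eq_lintegral_mul _ (measurable_radialDensity _ _ _)
    hm.lintegral_prod_right']
  rfl

/-- The expected mass of the neighbours of a vertex `w`, weighted by a function of their radial
coordinate. -/
theorem exists_lintegral_neighbours_le (n : ℕ) {α R₀ : ℝ} (hα : 0 < α) (hR₀ : 0 < R₀) :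
    ∃ C : ℝ, 0 < C ∧ ∀ R, R₀ ≤ R → ∀ w : EuclideanSpace ℝ (Fin (n + 2)), ‖w‖ < 1 → dH 0 w ≤ R →
      ∀ φ : ℝ → ℝ≥0∞, Measurable φ →
      ∫⁻ x, {x | dH x w ≤ R}.indicator (fun x => φ (R - dH 0 x)) x ∂vertexLaw (n + 2) α R ≤
        ENNReal.ofReal (C * Real.exp (-((n + 1) / 2 * dH 0 w))) *
          ∫⁻ t in Set.Icc 0 R, φ t * ENNReal.ofReal (Real.exp ((n + 1) * (1 / 2 - α) * t)) := by
  obtain ⟨C₁, hC₁, h₁⟩ := exists_angularLaw_cap_le n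
  obtain ⟨C₂, hC₂, h₂⟩ := exists_radialDensity_le n hα hR₀
  refine ⟨C₂ * (C₁ * 12 ^ (n + 1)), by positivity, fun R hR w hw hwR φ hφ => ?_⟩
  have hm1 := measurable_dH_left w
  have hm2 := measurable_dH_right (0 : EuclideanSpace ℝ (Fin (n + 2)))
  have hG : Measurable ({x : EuclideanSpace ℝ (Fin (n + 2)) | dH x w ≤ R}.indicator
      (fun x => φ (R - dH 0 x))) :=
    (hφ.comp (measurable_const.sub hm2)).indicator (measurableSet_le hm1 measurable_const)
  rw [lintegral_vertexLaw _ _ _ _ hG, ← lintegral_const_mul _ (by fun_prop)]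
  refine setLIntegral_mono' measurableSet_Icc fun t ht => ?_
  obtain ⟨e, he, hwe⟩ := exists_eq_tanh_smul (by omega) hw
  set b := dH 0 w
  have hb : 0 ≤ b := dH_nonneg (by simp) hw
  -- The maximal angular deviation of a neighbour of `w` at height t, that is at distance R - t from
  -- the origin.
  set r : ℝ := 12 * Real.exp ((R - (R - t) - b) / 2) with hr
  have hS : MeasurableSet {θ : Fin (n + 2 - 1) → ℝ | ‖direction (n + 2) θ - e‖ ≤ r} :=
    measurableSet_le ((continuous_direction _).measurable.sub_const _).norm measurable_const
  calc _ ≤ ENNReal.ofReal (C₂ * Real.exp (-(α * (n + 1) * t))) *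
        ∫⁻ θ, {θ : Fin (n + 2 - 1) → ℝ | ‖direction (n + 2) θ - e‖ ≤ r}.indicator (fun _ => φ t) θ
          ∂angularLaw (n + 2) := by
        refine mul_le_mul' (ENNReal.ofReal_le_ofReal (h₂ R hR t ht.1 ht.2))
          (lintegral_mono fun θ => ?_)
        by_cases h : dH (polarPoint (n + 2) R (t, θ)) w ≤ R
        · have h3 : ‖direction (n + 2) θ - e‖ ≤ r := by
            rw [hwe] at h
            exact norm_sub_le_of_dH_le (by linarith [ht.2]) hb (by linarith [ht.1]) hwR
              (norm_direction _ _) he h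
          rw [Set.indicator_of_mem (by exact h), Set.indicator_of_mem (by exact h3),
            dH_zero_polarPoint ht.2, sub_sub_cancel]
        · rw [Set.indicator_of_notMem (by exact h)]; exact zero_le
    _ ≤ ENNReal.ofReal (C₂ * Real.exp (-(α * (n + 1) * t))) *
        (φ t * ENNReal.ofReal (C₁ * r ^ (n + 1))) := by
        rw [lintegral_indicator_const hS]
        exact mul_le_mul' le_rfl (mul_le_mul' le_rfl (h₁ e r (by positivity)))
    _ = _ := by
        rw [mul_left_comm, ← ENNReal.ofReal_mul (by positivity), mul_left_comm (ENNReal.ofReal _),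
          ← ENNReal.ofReal_mul (by positivity)]
        congr 2
        have e1 : Real.exp ((R - (R - t) - b) / 2) ^ (n + 1) =
            Real.exp ((n + 1) / 2 * t) * Real.exp (-((n + 1) / 2 * b)) := by
          rw [← Real.exp_nat_mul, ← Real.exp_add]; congr 1; push_cast; ring
        have e2 : Real.exp ((n + 1) * (1 / 2 - α) * t) =
            Real.exp ((n + 1) / 2 * t) * Real.exp (-(α * (n + 1) * t)) := by
          rw [← Real.exp_add]; congr 1; ring
        rw [hr, mul_pow, e1, e2]
        ring

theorem ae_vertexLaw (n : ℕ) (α R : ℝ) :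
    ∀ᵐ x ∂vertexLaw (n + 2) α R, ‖x‖ < 1 ∧ dH 0 x ≤ R := by
  have hm2 := measurable_dH_right (0 : EuclideanSpace ℝ (Fin (n + 2)))
  have hS : MeasurableSet {x : EuclideanSpace ℝ (Fin (n + 2)) | ‖x‖ < 1 ∧ dH 0 x ≤ R} :=
    (measurableSet_lt measurable_norm measurable_const).inter (measurableSet_le hm2 measurable_const)
  rw [ae_iff, ← Set.compl_ofPred]
  have h1 := lintegral_vertexLaw n α R (Set.indicator {x | ‖x‖ < 1 ∧ dH 0 x ≤ R}ᶜ 1)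
    (measurable_one.indicator hS.compl)
  rw [lintegral_indicator_one hS.compl] at h1
  refine h1.trans ?_
  rw [← lintegral_zero (μ := volume.restrict (Set.Icc 0 R))]
  refine setLIntegral_congr_fun measurableSet_Icc fun t ht => ?_
  have : ∀ θ, Set.indicator {x : EuclideanSpace ℝ (Fin (n + 2)) | ‖x‖ < 1 ∧ dH 0 x ≤ R}ᶜ
      (1 : EuclideanSpace ℝ (Fin (n + 2)) → ℝ≥0∞) (polarPoint (n + 2) R (t, θ)) = 0 := fun θ => by
    refine Set.indicator_of_notMem ?_ _
    rw [Set.notMem_compl_iff, Set.mem_ofPred_eq, dH_zero_polarPoint ht.2]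
    exact ⟨norm_polarPoint_lt ht.2 θ, by linarith [ht.1]⟩
  simp [this]

/-- A point determines its radial coordinate, whose law has a density. Hence the sampled points are
almost surely distinct, and tuples of points can be counted as tuples of indices. -/
theorem vertexLaw_singleton (n : ℕ) (α R : ℝ) (x : EuclideanSpace ℝ (Fin (n + 2))) :
    vertexLaw (n + 2) α R {x} = 0 := by
  have h1 := lintegral_vertexLaw n α R (Set.indicator {x} 1)
    (measurable_one.indicator (measurableSet_singleton x))
  rw [lintegral_indicator_one (measurableSet_singleton x)] at h1
  rw [h1, lintegral_eq_zero_iff' ?_]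
  swap
  · refine (measurable_radialDensity _ _ _).aemeasurable.mul (Measurable.aemeasurable ?_)
    have hm : Measurable fun z => (Set.indicator {x} (1 : EuclideanSpace ℝ (Fin (n + 2)) → ℝ≥0∞)) (polarPoint (n + 2) R z) :=
      (measurable_one.indicator (measurableSet_singleton x)).comp
        (continuous_polarPoint (n + 1) R).measurable
    exact hm.lintegral_prod_right'
  have h2 : ∀ᵐ t ∂(volume.restrict (Set.Icc 0 R)), t ≠ R - dH 0 x :=
    ae_restrict_of_ae (Measure.ae_ne volume _)
  filter_upwards [h2, ae_restrict_mem measurableSet_Icc] with t ht htI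
  have : ∀ θ, Set.indicator {x} (1 : EuclideanSpace ℝ (Fin (n + 2)) → ℝ≥0∞) (polarPoint (n + 2) R (t, θ)) = 0 := fun θ => by
    refine Set.indicator_of_notMem (fun h => ht ?_) _
    rw [← Set.mem_singleton_iff.1 h, dH_zero_polarPoint htI.2]
    ring
  simp only [this, lintegral_zero, mul_zero, Pi.zero_apply]

/-! ### Extended nonnegative exponentials and indicators. -/

/-- The exponential function with values in `ℝ≥0∞`. -/
noncomputable def eexp (x : ℝ) : ℝ≥0∞ := ENNReal.ofReal (Real.exp x)

theorem eexp_add (x y : ℝ) : eexp (x + y) = eexp x * eexp y := by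
  unfold eexp
  rw [Real.exp_add, ENNReal.ofReal_mul (Real.exp_pos x).le]

theorem eexp_mono {x y : ℝ} (h : x ≤ y) : eexp x ≤ eexp y :=
  ENNReal.ofReal_le_ofReal (Real.exp_le_exp.2 h)

theorem eexp_zero : eexp 0 = 1 := by simp [eexp]

theorem one_le_eexp {x : ℝ} (h : 0 ≤ x) : 1 ≤ eexp x := eexp_zero ▸ eexp_mono h

theorem eexp_pow (x : ℝ) (n : ℕ) : eexp x ^ n = eexp (n * x) := by
  unfold eexp
  rw [Real.exp_nat_mul, ENNReal.ofReal_pow (Real.exp_pos x).le]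

@[fun_prop]
theorem measurable_eexp : Measurable eexp := by unfold eexp; fun_prop

open Classical in
/-- The indicator of a proposition. -/
noncomputable def ind (P : Prop) : ℝ≥0∞ := if P then 1 else 0

theorem ind_of_true {P : Prop} (h : P) : ind P = 1 := if_pos h

theorem ind_of_false {P : Prop} (h : ¬P) : ind P = 0 := if_neg h

theorem ind_le_one (P : Prop) : ind P ≤ 1 := by unfold ind; split_ifs <;> simp

theorem ind_mono {P Q : Prop} (h : P → Q) : ind P ≤ ind Q := by
  by_cases hP : P
  · rw [ind_of_true hP, ind_of_true (h hP)]
  · rw [ind_of_false hP]; exact zero_le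

theorem ind_and (P Q : Prop) : ind (P ∧ Q) = ind P * ind Q := by
  by_cases hP : P <;> by_cases hQ : Q <;> simp [ind, hP, hQ]

theorem ind_forall_mem {ι : Type*} (s : Finset ι) (P : ι → Prop) :
    ind (∀ i ∈ s, P i) = ∏ i ∈ s, ind (P i) := by
  classical
  induction s using Finset.induction_on with
  | empty => simp [ind]
  | insert i s hi ih => rw [Finset.prod_insert hi, ← ih, ← ind_and, Finset.forall_mem_insert]

theorem measurable_ind {X : Type*} [MeasurableSpace X] {P : X → Prop}
    (h : MeasurableSet {x | P x}) : Measurable fun x => ind (P x) := by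
  unfold ind
  exact Measurable.ite h measurable_const measurable_const

theorem lintegral_Ici_eexp_neg {c τ : ℝ} (hc : 0 < c) :
    ∫⁻ t in Set.Ici τ, eexp (-(c * t)) = ENNReal.ofReal (1 / c) * eexp (-(c * τ)) := by
  unfold eexp
  rw [← restrict_Ioi_eq_restrict_Ici, ← ofReal_integral_eq_lintegral_ofReal,
    ← ENNReal.ofReal_mul (by positivity)]
  · have := integral_exp_mul_Ioi (a := -c) (by linarith) τ
    simp only [neg_mul] at this
    rw [this]
    congr 1
    field_simp
  · have := integrableOn_exp_mul_Ioi (a := -c) (by linarith) τ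
    simpa only [neg_mul, IntegrableOn] using this
  · exact Filter.Eventually.of_forall fun x => (Real.exp_pos _).le

theorem lintegral_Iic_eexp_le {c u : ℝ} (hc : 0 < c) :
    ∫⁻ t in Set.Iic u, eexp (c * t) ≤ ENNReal.ofReal (1 / c) * eexp (c * u) := by
  unfold eexp
  rw [← ofReal_integral_eq_lintegral_ofReal, ← ENNReal.ofReal_mul (by positivity)]
  · have := integral_exp_mul_Iic (a := c) hc u
    rw [this]
    apply le_of_eq
    congr 1
    field_simp
  · exact integrableOn_exp_mul_Iic hc u
  · exact Filter.Eventually.of_forall fun x => (Real.exp_pos _).le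

/-! ### The abstract neighbour bound and integrals over one vertex. -/

/-- A vertex `w` at height `h w` has at most `K exp (a h w - β t) dt` expected neighbours whose
height is in `dt`. -/
structure NeighbourBound {E : Type*} [MeasurableSpace E] (μ : Measure E) (adj : E → E → Prop)
    (h : E → ℝ) (G : Set E) (a β : ℝ) (K : ℝ≥0∞) : Prop where
  measurableSet_adj : MeasurableSet {z : E × E | adj z.1 z.2}
  measurable_height : Measurable h
  measurableSet_good : MeasurableSet G
  ae_mem : ∀ᵐ x ∂μ, x ∈ G
  height_nonneg : ∀ x ∈ G, 0 ≤ h x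
  lintegral_le : ∀ w ∈ G, ∀ φ : ℝ → ℝ≥0∞, Measurable φ →
    ∫⁻ x, ind (adj x w) * φ (h x) ∂μ ≤
      K * eexp (a * h w) * ∫⁻ t in Set.Ici 0, φ t * eexp (-(β * t))

namespace NeighbourBound

variable {E : Type*} [MeasurableSpace E] {μ : Measure E} {adj : E → E → Prop}
  {h : E → ℝ} {G : Set E} {a β : ℝ} {K : ℝ≥0∞}

/-- For c < β the integral is governed by its lower end τ. With c = 0 and τ = h w, the expected
number of neighbours above `w` is O(exp((a-β) h w)). -/
theorem lintegral_above_le (H : NeighbourBound μ adj h G a β K) {w : E} (hw : w ∈ G) {c τ : ℝ}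
    (hc : c < β) :
    ∫⁻ x, ind (adj x w) * (ind (τ ≤ h x) * eexp (c * h x)) ∂μ ≤
      K * ENNReal.ofReal (1 / (β - c)) * eexp (a * h w) * eexp (-((β - c) * τ)) := by
  have hm : Measurable fun t : ℝ => ind (τ ≤ t) * eexp (c * t) :=
    (measurable_ind measurableSet_Ici).mul (by fun_prop)
  refine (H.lintegral_le w hw _ hm).trans ?_
  calc _ ≤ K * eexp (a * h w) * ∫⁻ t in Set.Ici τ, eexp (-((β - c) * t)) := by
        refine mul_le_mul' le_rfl ?_
        rw [← lintegral_indicator measurableSet_Ici, ← lintegral_indicator measurableSet_Ici]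
        refine lintegral_mono fun t => ?_
        by_cases h1 : τ ≤ t
        · rw [Set.indicator_of_mem (show t ∈ Set.Ici τ from h1)]
          refine (Set.indicator_le_self _ _ _).trans ?_
          rw [ind_of_true h1, one_mul, ← eexp_add]
          exact eexp_mono (by linarith)
        · refine (Set.indicator_le_self _ _ _).trans ?_
          rw [ind_of_false h1]; simp
    _ = _ := by rw [lintegral_Ici_eexp_neg (by linarith)]; ring

theorem lintegral_neighbours_le (H : NeighbourBound μ adj h G a β K) {w : E} (hw : w ∈ G) {c : ℝ}
    (hc : c < β) :
    ∫⁻ x, ind (adj x w) * eexp (c * h x) ∂μ ≤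
      K * ENNReal.ofReal (1 / (β - c)) * eexp (a * h w) := by
  have hm : Measurable fun t : ℝ => eexp (c * t) := by fun_prop
  refine (H.lintegral_le w hw _ hm).trans_eq ?_
  calc _ = K * eexp (a * h w) * ∫⁻ t in Set.Ici 0, eexp (-((β - c) * t)) := by
        congr 1
        refine lintegral_congr fun t => ?_
        rw [← eexp_add]
        ring_nf
    _ = _ := by rw [lintegral_Ici_eexp_neg (by linarith), mul_zero, neg_zero, eexp_zero, mul_one]; ring

/-- For c > β the weight beats the decay, and the integral is governed by its upper end u. -/
theorem lintegral_below_le (H : NeighbourBound μ adj h G a β K) {w : E} (hw : w ∈ G) {c u : ℝ}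
    (hc : β < c) :
    ∫⁻ x, ind (adj x w) * (ind (h x ≤ u) * eexp (c * h x)) ∂μ ≤
      K * ENNReal.ofReal (1 / (c - β)) * eexp (a * h w) * eexp ((c - β) * u) := by
  have hm : Measurable fun t : ℝ => ind (t ≤ u) * eexp (c * t) :=
    (measurable_ind measurableSet_Iic).mul (by fun_prop)
  refine (H.lintegral_le w hw _ hm).trans ?_
  calc _ ≤ K * eexp (a * h w) * ∫⁻ t in Set.Iic u, eexp ((c - β) * t) := by
        refine mul_le_mul' le_rfl ?_
        rw [← lintegral_indicator measurableSet_Ici, ← lintegral_indicator measurableSet_Iic]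
        refine lintegral_mono fun t => ?_
        by_cases h1 : t ≤ u
        · rw [Set.indicator_of_mem (show t ∈ Set.Iic u from h1)]
          refine (Set.indicator_le_self _ _ _).trans ?_
          rw [ind_of_true h1, one_mul, ← eexp_add]
          exact eexp_mono (by linarith)
        · refine (Set.indicator_le_self _ _ _).trans ?_
          rw [ind_of_false h1]; simp
    _ ≤ K * eexp (a * h w) * (ENNReal.ofReal (1 / (c - β)) * eexp ((c - β) * u)) := by
        gcongr
        exact lintegral_Iic_eexp_le (by linarith)
    _ = _ := by ring

end NeighbourBound

/-! ### Integrating out the vertices of two overlapping cliques. -/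

theorem lmarginal_insert_le {ι E : Type*} [DecidableEq ι] [MeasurableSpace E]
    {μ : Measure E} [SigmaFinite μ] {F F' : (ι → E) → ℝ≥0∞} (hF : Measurable F) {s : Finset ι}
    {i : ι} (hi : i ∉ s) (h : ∀ y, ∫⁻ x, F (Function.update y i x) ∂μ ≤ F' y) :
    ∫⋯∫⁻_insert i s, F ∂(fun _ => μ) ≤ ∫⋯∫⁻_s, F' ∂(fun _ => μ) := by
  rw [lmarginal_insert' F hF hi]
  exact lmarginal_mono h

/-- Integrating out all coordinates outside `T` from an integrand which is a product of a function
`g` of the coordinates in `T` and of factors `q i`, each involving one more coordinate. -/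
theorem lmarginal_union_prod_le {ι E : Type*} [DecidableEq ι] [MeasurableSpace E]
    {μ : Measure E} [SigmaFinite μ] (g H : (ι → E) → ℝ≥0∞) (q : ι → (ι → E) → ℝ≥0∞)
    (hg : Measurable g) (hH : Measurable H) (hq : ∀ i, Measurable (q i)) (T S : Finset ι)
    (hTS : Disjoint T S)
    (hgi : ∀ i ∉ T, ∀ y x, g (Function.update y i x) = g y)
    (hHi : ∀ i ∉ T, ∀ y x, H (Function.update y i x) = H y)
    (hqi : ∀ j ∉ T, ∀ i ∉ T, i ≠ j → ∀ y x, q j (Function.update y i x) = q j y)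
    (hqH : ∀ i ∉ T, ∀ y, g y ≠ 0 → ∫⁻ x, q i (Function.update y i x) ∂μ ≤ H y) :
    ∫⋯∫⁻_T ∪ S, (fun y => g y * ∏ i ∈ S, q i y) ∂(fun _ => μ) ≤
      ∫⋯∫⁻_T, (fun y => g y * H y ^ S.card) ∂(fun _ => μ) := by
  -- Each coordinate integrated out leaves a factor `H y`; the exponent `c` records those already
  -- collected, so that the induction closes.
  suffices hs : ∀ c : ℕ, ∫⋯∫⁻_T ∪ S, (fun y => g y * H y ^ c * ∏ i ∈ S, q i y) ∂(fun _ => μ) ≤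
      ∫⋯∫⁻_T, (fun y => g y * H y ^ (c + S.card)) ∂(fun _ => μ) by
    simpa using hs 0
  induction S using Finset.induction_on with
  | empty => intro c; simp
  | insert i S hi ih =>
    intro c
    rw [Finset.disjoint_insert_right] at hTS
    rw [Finset.union_insert, Finset.card_insert_of_notMem hi]
    have hiTS : i ∉ T ∪ S := by
      rw [Finset.mem_union]; exact fun h => h.elim hTS.1 hi
    refine le_trans ?_ ((ih hTS.2 (c + 1)).trans_eq (by simp only [add_comm, add_left_comm]))
    refine lmarginal_insert_le ?_ hiTS fun y => ?_
    · exact (hg.mul (hH.pow_const _)).mul (Finset.measurable_prod _ fun j _ => hq j)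
    have e1 : ∀ x, ∏ j ∈ S, q j (Function.update y i x) = ∏ j ∈ S, q j y := fun x =>
      Finset.prod_congr rfl fun j hj => hqi j (fun h => (Finset.disjoint_left.1 hTS.2) h hj) i hTS.1
        (fun h => hi (h ▸ hj)) y x
    simp only [Finset.prod_insert hi, hgi i hTS.1, hHi i hTS.1, e1]
    by_cases hg0 : g y = 0
    · simp [hg0]
    calc _ = ∫⁻ x, (g y * H y ^ c * ∏ j ∈ S, q j y) * q i (Function.update y i x) ∂μ :=
          lintegral_congr fun x => by ring
      _ = (g y * H y ^ c * ∏ j ∈ S, q j y) * ∫⁻ x, q i (Function.update y i x) ∂μ :=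
          lintegral_const_mul _ ((hq i).comp (measurable_update y))
      _ ≤ (g y * H y ^ c * ∏ j ∈ S, q j y) * H y := by gcongr; exact hqH i hTS.1 y hg0
      _ = _ := by ring

/-- `y` forms a clique together with `p`, and its heights are increasing and at most that of `p`. -/
def IsOrderedClique {E : Type*} (adj : E → E → Prop) (h : E → ℝ) (p : E) {k : ℕ} (y : Fin k → E) :
    Prop :=
  (∀ i j, adj (y i) (y j)) ∧ (∀ i, adj (y i) p) ∧ Monotone (fun i => h (y i)) ∧ ∀ i, h (y i) ≤ h p

namespace NeighbourBound

variable {E : Type*} [MeasurableSpace E] {μ : Measure E} {adj : E → E → Prop}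
  {h : E → ℝ} {G : Set E} {a η δ : ℝ} {K M : ℝ≥0∞}

theorem measurableSet_adj_apply {β : ℝ} (H : NeighbourBound μ adj h G a β K) {ι : Type*} (i j : ι) :
    MeasurableSet {y : ι → E | adj (y i) (y j)} := by
  have hm : Measurable fun y : ι → E => (y i, y j) := by fun_prop
  exact hm H.measurableSet_adj

theorem measurableSet_adj_const {β : ℝ} (H : NeighbourBound μ adj h G a β K) {ι : Type*} (i : ι)
    (p : E) : MeasurableSet {y : ι → E | adj (y i) p} := by
  have hm : Measurable fun y : ι → E => (y i, p) := by fun_prop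
  exact hm H.measurableSet_adj

theorem measurable_height_apply {β : ℝ} (H : NeighbourBound μ adj h G a β K) {ι : Type*} (i : ι) :
    Measurable fun y : ι → E => h (y i) :=
  H.measurable_height.comp (measurable_pi_apply i)

theorem measurableSet_isOrderedClique {β : ℝ} (H : NeighbourBound μ adj h G a β K) (p : E) {k : ℕ} :
    MeasurableSet {y : Fin k → E | IsOrderedClique adj h p y} := by
  have h1 : MeasurableSet {y : Fin k → E | ∀ i j, adj (y i) (y j)} := by
    simp only [Set.ofPred_forall]
    exact MeasurableSet.iInter fun i => MeasurableSet.iInter fun j => H.measurableSet_adj_apply i j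
  have h2 : MeasurableSet {y : Fin k → E | ∀ i, adj (y i) p} := by
    simp only [Set.ofPred_forall]
    exact MeasurableSet.iInter fun i => H.measurableSet_adj_const i p
  have h3 : MeasurableSet {y : Fin k → E | Monotone (fun i => h (y i))} := by
    unfold Monotone
    simp only [Set.ofPred_forall]
    exact MeasurableSet.iInter fun i => MeasurableSet.iInter fun j => MeasurableSet.iInter fun _ =>
      measurableSet_le (H.measurable_height_apply i) (H.measurable_height_apply j)
  have h4 : MeasurableSet {y : Fin k → E | ∀ i, h (y i) ≤ h p} := by
    simp only [Set.ofPred_forall]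
    exact MeasurableSet.iInter fun i =>
      measurableSet_le (H.measurable_height_apply i) measurable_const
  exact h1.inter (h2.inter (h3.inter h4))

/-- Integrating out the lowest vertex of the higher clique. -/
theorem lintegral_top_le (H : NeighbourBound μ adj h G a (a - η) K) (hη : 0 < η) (hδ : 0 < δ)
    (hM : 1 ≤ M) (hMδ : K * ENNReal.ofReal (1 / δ) ≤ M) {w : E} (hw : w ∈ G) {c N : ℕ} (hcN : c ≤ N)
    {γ s t u : ℝ} (hγ : 0 ≤ γ) (hs : 0 ≤ s) (h1 : N * η + γ ≤ s + (a - η - δ)) :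
    ∫⁻ x, ind (x ∈ G ∧ adj x w ∧ h x ≤ u ∧ t ≤ h x) * (M * eexp (η * h x)) ^ c ∂μ ≤
      M ^ (N + 1) * eexp (-(γ * t)) * eexp (s * u) * eexp (a * h w) := by
  calc _ ≤ ∫⁻ x, (M ^ N * eexp (-(γ * t)) * eexp (s * u)) *
        (ind (adj x w) * eexp ((a - η - δ) * h x)) ∂μ := by
        refine lintegral_mono fun x => ?_
        by_cases hx : x ∈ G ∧ adj x w ∧ h x ≤ u ∧ t ≤ h x
        swap
        · rw [ind_of_false hx]; simp
        have h0 := H.height_nonneg x hx.1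
        rw [ind_of_true hx, ind_of_true hx.2.1, one_mul, one_mul]
        calc (M * eexp (η * h x)) ^ c ≤ (M * eexp (η * h x)) ^ N :=
              pow_le_pow_right₀ (one_le_mul hM (one_le_eexp (by positivity))) hcN
          _ = M ^ N * eexp (N * (η * h x)) := by rw [mul_pow, eexp_pow]
          _ ≤ M ^ N * eexp (-(γ * t) + s * u + (a - η - δ) * h x) := by
              gcongr
              -- `h1` is multiplied by h x; then t ≤ h x turns the γ-part into decay in t, and h x ≤
              -- u charges the s-part to u. Against the decay rate a - η, the remaining weight a - η
              -- - δ leaves exp(-δ h x), which is integrable.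
              refine eexp_mono ?_
              have e1 := mul_le_mul_of_nonneg_right h1 h0
              have e2 := mul_le_mul_of_nonneg_left hx.2.2.1 hs
              have e3 := mul_le_mul_of_nonneg_left hx.2.2.2 hγ
              linarith
          _ = _ := by rw [eexp_add, eexp_add]; ring
    _ ≤ (M ^ N * eexp (-(γ * t)) * eexp (s * u)) * (M * eexp (a * h w)) := by
        rw [lintegral_const_mul]
        · refine mul_le_mul' le_rfl ((H.lintegral_neighbours_le hw (by linarith)).trans ?_)
          rw [sub_sub_cancel]
          gcongr
        · exact (measurable_ind (measurable_id.prodMk measurable_const H.measurableSet_adj)).mul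
            (measurable_eexp.comp (H.measurable_height.const_mul _))
    _ = _ := by ring

/-- Integrating out a shared vertex that is not the lowest of either clique. -/
theorem lintegral_shared_le (H : NeighbourBound μ adj h G a (a - η) K) (hη : 0 < η)
    (hMη : K * ENNReal.ofReal (1 / η) ≤ M) {w : E} (hw : w ∈ G) {u : ℝ} :
    ∫⁻ x, ind (x ∈ G ∧ adj x w ∧ h x ≤ u) * eexp (a * h x) ∂μ ≤
      M * eexp (η * u) * eexp (a * h w) := by
  calc _ ≤ ∫⁻ x, ind (adj x w) * (ind (h x ≤ u) * eexp (a * h x)) ∂μ := by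
        refine lintegral_mono fun x => ?_
        rw [ind_and, ind_and, ← mul_assoc (ind (adj x w))]
        refine mul_le_mul' ?_ le_rfl
        calc _ ≤ 1 * (ind (adj x w) * ind (h x ≤ u)) := mul_le_mul' (ind_le_one _) le_rfl
          _ = _ := one_mul _
    _ ≤ _ := by
        refine (H.lintegral_below_le hw (by linarith)).trans ?_
        rw [sub_sub_cancel, mul_right_comm]
        gcongr

/-- Integrating out the lowest vertex. -/
theorem lintegral_lowest_le (H : NeighbourBound μ adj h G a (a - η) K) (hδ : 0 < δ)
    (hMδ : K * ENNReal.ofReal (1 / δ) ≤ M) {p : E} (hp : p ∈ G) :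
    ∫⁻ x, ind (x ∈ G ∧ adj x p) * (eexp (-((η + δ) * h x)) * eexp (a * h x)) ∂μ ≤
      M * eexp (a * h p) := by
  calc _ ≤ ∫⁻ x, ind (adj x p) * eexp ((a - η - δ) * h x) ∂μ := by
        refine lintegral_mono fun x => ?_
        rw [ind_and, ← eexp_add]
        gcongr
        · calc _ ≤ 1 * ind (adj x p) := by gcongr; exact ind_le_one _
            _ = _ := one_mul _
        · exact eexp_mono (by linarith)
    _ ≤ _ := by
        refine (H.lintegral_neighbours_le hp (by linarith)).trans ?_
        rw [sub_sub_cancel]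
        gcongr

/-- Integrating out all vertices except for a few ones which include the lowest vertices `σ 0`
and `τ 0` of the two cliques. -/
theorem lintegral_pattern_le_lmarginal [SigmaFinite μ]
    (H : NeighbourBound μ adj h G a (a - η) K) (hη : 0 < η) (hηa : η < a)
    (hMβ : K * ENNReal.ofReal (1 / (a - η)) ≤ M) {k ℓ : ℕ}
    (σ τ : Fin (k + 1) ↪ Fin ℓ) (hcov : ∀ i, i ∈ Set.range σ ∨ i ∈ Set.range τ) (p : E)
    (T : Finset (Fin ℓ)) (hA : σ 0 ∈ T) (hB : τ 0 ∈ T) (P : (Fin ℓ → E) → Prop)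
    (hPm : MeasurableSet {y | P y}) (hPT : ∀ i ∉ T, ∀ y x, P (Function.update y i x) ↔ P y)
    (hPG : ∀ y, P y → y (σ 0) ∈ G ∧ y (τ 0) ∈ G ∧ h (y (σ 0)) ≤ h (y (τ 0)))
    (hP : ∀ y, (∀ i, y i ∈ G) → IsOrderedClique adj h p (fun i => y (σ i)) →
      IsOrderedClique adj h p (fun i => y (τ i)) → h (y (σ 0)) ≤ h (y (τ 0)) → P y)
    (y₀ : Fin ℓ → E) :
    ∫⁻ y, ind (IsOrderedClique adj h p (fun i => y (σ i)) ∧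
      IsOrderedClique adj h p (fun i => y (τ i)) ∧ h (y (σ 0)) ≤ h (y (τ 0)))
        ∂Measure.pi (fun _ => μ) ≤
    (∫⋯∫⁻_T, (fun y => ind (P y) * (M * eexp (η * h (y (τ 0)))) ^ (Tᶜ).card) ∂(fun _ => μ)) y₀ := by
  classical
  -- The parent of a vertex is the lowest vertex of a clique containing it. Outside `T`, only the
  -- edge to the parent and the height comparison with it are kept, which makes the integrand a
  -- product.
  set par : Fin ℓ → Fin ℓ := fun i => if i ∈ Set.range σ then σ 0 else τ 0 with hpar
  have hparT : ∀ i, par i ∈ T := fun i => by simp only [hpar]; split_ifs <;> assumption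
  set q : Fin ℓ → (Fin ℓ → E) → ℝ≥0∞ := fun i y =>
    ind (adj (y i) (y (par i)) ∧ h (y (par i)) ≤ h (y i)) with hq
  have hgood : ∀ᵐ y ∂Measure.pi (fun _ : Fin ℓ => μ), ∀ i, y i ∈ G :=
    ae_all_iff.2 fun i => (Measure.quasiMeasurePreserving_eval (fun _ : Fin ℓ => μ) i).ae H.ae_mem
  calc _ ≤ ∫⁻ y, ind (P y) * ∏ i ∈ Tᶜ, q i y ∂Measure.pi (fun _ => μ) := by
        refine lintegral_mono_ae ?_
        filter_upwards [hgood] with y hy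
        rw [hq, ← ind_forall_mem, ← ind_and]
        refine ind_mono fun ⟨h1, h2, h3⟩ => ⟨hP y hy h1 h2 h3, fun i _ => ?_⟩
        simp only [hpar]
        by_cases hi : i ∈ Set.range σ
        · rw [if_pos hi]
          obtain ⟨i, rfl⟩ := hi
          exact ⟨h1.1 _ _, h1.2.2.1 (Fin.zero_le _)⟩
        · rw [if_neg hi]
          obtain ⟨i, rfl⟩ := (hcov i).resolve_left hi
          exact ⟨h2.1 _ _, h2.2.2.1 (Fin.zero_le _)⟩
    _ = (∫⋯∫⁻_T ∪ Tᶜ, (fun y => ind (P y) * ∏ i ∈ Tᶜ, q i y) ∂(fun _ => μ)) y₀ := by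
        rw [Finset.union_compl, lmarginal_univ]
    _ ≤ _ := by
        refine lmarginal_union_prod_le (fun y => ind (P y)) (fun y => M * eexp (η * h (y (τ 0)))) q
          (measurable_ind hPm) ?_ ?_ T Tᶜ disjoint_compl_right ?_ ?_ ?_ ?_ y₀
        · exact (measurable_eexp.comp ((H.measurable_height_apply _).const_mul _)).const_mul _
        · intro i
          exact measurable_ind ((H.measurableSet_adj_apply _ _).inter
            (measurableSet_le (H.measurable_height_apply _) (H.measurable_height_apply _)))
        · intro i hi y x
          exact congrArg ind (propext (hPT i hi y x))
        · intro i hi y x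
          rw [Function.update_of_ne fun he => hi (by rw [← he]; exact hB)]
        · intro j hj i hi hij y x
          simp only [hq]
          rw [Function.update_of_ne hij.symm, Function.update_of_ne (fun he => hi (by rw [← he]; exact hparT j) : par j ≠ i)]
        · intro i hi y hy
          have hPy : P y := by by_contra hc; exact hy (ind_of_false hc)
          obtain ⟨hAG, hBG, hAB⟩ := hPG y hPy
          have hparG : y (par i) ∈ G := by simp only [hpar]; split_ifs <;> assumption
          have hpary : h (y (par i)) ≤ h (y (τ 0)) := by
            simp only [hpar]; split_ifs <;> [exact hAB; exact le_rfl]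
          simp only [hq]
          have hne : par i ≠ i := fun he => hi (he ▸ hparT i)
          simp only [Function.update_self, Function.update_of_ne hne]
          calc _ = ∫⁻ x, ind (adj x (y (par i))) *
                (ind (h (y (par i)) ≤ h x) * eexp (0 * h x)) ∂μ := by
                simp only [ind_and, zero_mul, eexp_zero, mul_one]
            _ ≤ _ := H.lintegral_above_le hparG (by linarith)
            -- The mass above the parent's height is O(exp(η h(parent))), and the parent is at most
            -- as high as `τ 0`.
            _ ≤ M * eexp (a * h (y (par i))) * eexp (-((a - η) * h (y (par i)))) := by
                rw [sub_zero]; gcongr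
            _ = M * eexp (η * h (y (par i))) := by
                rw [mul_assoc, ← eexp_add]; congr 2; ring
            _ ≤ _ := by gcongr; exact eexp_mono (by nlinarith)

end NeighbourBound

/-! ### The paths from the higher lowest vertex to p. -/

namespace NeighbourBound

variable {E : Type*} [MeasurableSpace E] {μ : Measure E} {adj : E → E → Prop}
  {h : E → ℝ} {G : Set E} {a η δ : ℝ} {K M : ℝ≥0∞}

theorem measurableSet_mem_apply {β : ℝ} (H : NeighbourBound μ adj h G a β K) {ι : Type*} (i : ι) :
    MeasurableSet {y : ι → E | y i ∈ G} :=
  measurable_pi_apply i H.measurableSet_good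

theorem measurable_eexp_height {β : ℝ} (H : NeighbourBound μ adj h G a β K) {ι : Type*} (i : ι)
    (c : ℝ) : Measurable fun y : ι → E => eexp (c * h (y i)) :=
  measurable_eexp.comp ((H.measurable_height_apply i).const_mul c)

/-- Path B–p. The at most 2j+2 other vertices cost exp((2j+2)η h(B)); half of this exponent is
charged to u, and the other half is absorbed by the decay in h(B), as (j+2)η < a. -/
theorem lintegral_pattern_le_of_eq [SigmaFinite μ]
    (H : NeighbourBound μ adj h G a (a - η) K) (hη : 0 < η) (hηa : η < a) (hδ : 0 < δ)
    (hM : 1 ≤ M) (hMδ : K * ENNReal.ofReal (1 / δ) ≤ M)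
    (hMβ : K * ENNReal.ofReal (1 / (a - η)) ≤ M) {j ℓ : ℕ} (hj : (j + 2) * η + 2 * δ ≤ a)
    (hℓ : ℓ < 2 * (j + 2)) (σ τ : Fin (j + 2) ↪ Fin ℓ)
    (hcov : ∀ i, i ∈ Set.range σ ∨ i ∈ Set.range τ) {p : E} (hp : p ∈ G) (hAB : σ 0 = τ 0) :
    ∫⁻ y, ind (IsOrderedClique adj h p (fun i => y (σ i)) ∧
      IsOrderedClique adj h p (fun i => y (τ i)) ∧ h (y (σ 0)) ≤ h (y (τ 0)))
        ∂Measure.pi (fun _ => μ) ≤ M ^ (2 * j + 3) * eexp ((a + (j + 1) * η) * h p) := by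
  classical
  set T : Finset (Fin ℓ) := {τ 0} with hT
  have hc : (Tᶜ).card ≤ 2 * j + 2 := by
    rw [Finset.card_compl, Fintype.card_fin, hT, Finset.card_singleton]; omega
  have hmP : MeasurableSet {y : Fin ℓ → E | y (τ 0) ∈ G ∧ adj (y (τ 0)) p ∧ h (y (τ 0)) ≤ h p ∧
      0 ≤ h (y (τ 0))} :=
    (H.measurableSet_mem_apply _).inter ((H.measurableSet_adj_const _ _).inter
      ((measurableSet_le (H.measurable_height_apply _) measurable_const).inter
        (measurableSet_le measurable_const (H.measurable_height_apply _))))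
  refine (H.lintegral_pattern_le_lmarginal hη hηa hMβ σ τ hcov p T (by simp [hT, hAB]) (by simp [hT])
    (fun y => y (τ 0) ∈ G ∧ adj (y (τ 0)) p ∧ h (y (τ 0)) ≤ h p ∧ 0 ≤ h (y (τ 0))) hmP ?_ ?_ ?_
    (fun _ => p)).trans ?_
  · intro i hi y x
    have hne : τ 0 ≠ i := fun he => hi (by simp [hT, he])
    simp only [Function.update_of_ne hne]
  · intro y hy
    rw [hAB]
    exact ⟨hy.1, hy.1, le_rfl⟩
  · intro y hG h1 h2 h3
    exact ⟨hG _, h2.2.1 _, h2.2.2.2 _, H.height_nonneg _ (hG _)⟩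
  have step : ∀ y : Fin ℓ → E, _ ≤ M ^ (2 * j + 2 + 1) * eexp ((a + (j + 1) * η) * h p) := fun y => by
    refine (H.lintegral_top_le (c := (Tᶜ).card) (N := 2 * j + 2) (γ := 0) (s := (j + 1) * η)
      (t := 0) (u := h p) hη hδ hM hMδ hp hc le_rfl (by positivity) ?_).trans_eq ?_
    · push_cast; linarith
    · rw [zero_mul, neg_zero, eexp_zero, mul_one, mul_assoc, ← eexp_add]
      congr 2; ring
  refine (lmarginal_insert_le (s := ∅) ?_ (Finset.notMem_empty _)
    (F' := fun _ => M ^ (2 * j + 2 + 1) * eexp ((a + (j + 1) * η) * h p)) (fun y => ?_) _).trans ?_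
  · exact (measurable_ind hmP).mul
      (((H.measurable_eexp_height _ _).const_mul _).pow_const _)
  · simp only [Function.update_self]
    exact step y
  · rw [lmarginal_empty]

/-- Path B–A–p, B being joined to A inside one of the cliques. The constraint h(A) ≤ h(B) gains
exp(-(η+δ) h(A)), which makes the later integral over A converge. -/
theorem lintegral_pattern_le_of_adj [SigmaFinite μ]
    (H : NeighbourBound μ adj h G a (a - η) K) (hη : 0 < η) (hηa : η < a) (hδ : 0 < δ)
    (hM : 1 ≤ M) (hMδ : K * ENNReal.ofReal (1 / δ) ≤ M)
    (hMβ : K * ENNReal.ofReal (1 / (a - η)) ≤ M) {j ℓ : ℕ} (hj : (j + 2) * η + 2 * δ ≤ a)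
    (hℓ : ℓ < 2 * (j + 2)) (σ τ : Fin (j + 2) ↪ Fin ℓ)
    (hcov : ∀ i, i ∈ Set.range σ ∨ i ∈ Set.range τ) {p : E} (hp : p ∈ G) (hAB : σ 0 ≠ τ 0)
    (hadj : τ 0 ∈ Set.range σ ∨ σ 0 ∈ Set.range τ) :
    ∫⁻ y, ind (IsOrderedClique adj h p (fun i => y (σ i)) ∧
      IsOrderedClique adj h p (fun i => y (τ i)) ∧ h (y (σ 0)) ≤ h (y (τ 0)))
        ∂Measure.pi (fun _ => μ) ≤ M ^ (2 * j + 3) * eexp ((a + (j + 1) * η) * h p) := by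
  classical
  set A := σ 0
  set B := τ 0
  set T : Finset (Fin ℓ) := {B, A} with hT
  have hc : (Tᶜ).card ≤ 2 * j + 1 := by
    rw [Finset.card_compl, Fintype.card_fin, hT, Finset.card_pair hAB.symm]; omega
  have hmA : MeasurableSet {y : Fin ℓ → E | y A ∈ G ∧ adj (y A) p} :=
    (H.measurableSet_mem_apply _).inter (H.measurableSet_adj_const _ _)
  have hmB : MeasurableSet {y : Fin ℓ → E | y B ∈ G ∧ adj (y B) (y A) ∧ h (y B) ≤ h p ∧
      h (y A) ≤ h (y B)} :=
    (H.measurableSet_mem_apply _).inter ((H.measurableSet_adj_apply _ _).inter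
      ((measurableSet_le (H.measurable_height_apply _) measurable_const).inter
        (measurableSet_le (H.measurable_height_apply _) (H.measurable_height_apply _))))
  refine (H.lintegral_pattern_le_lmarginal hη hηa hMβ σ τ hcov p T (by simp [hT, A]) (by simp [hT, B])
    (fun y => (y A ∈ G ∧ adj (y A) p) ∧ (y B ∈ G ∧ adj (y B) (y A) ∧ h (y B) ≤ h p ∧
      h (y A) ≤ h (y B))) (hmA.inter hmB) ?_ ?_ ?_ (fun _ => p)).trans ?_
  · intro i hi y x
    have hne : A ≠ i := fun he => hi (by simp [hT, he])
    have hne' : B ≠ i := fun he => hi (by simp [hT, he])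
    simp only [Function.update_of_ne hne, Function.update_of_ne hne']
  · intro y hy
    exact ⟨hy.1.1, hy.2.1, hy.2.2.2.2⟩
  · intro y hG h1 h2 h3
    refine ⟨⟨hG _, h1.2.1 0⟩, hG _, ?_, h2.2.2.2 0, h3⟩
    rcases hadj with ⟨i, hi⟩ | ⟨i, hi⟩
    · rw [← hi]; exact h1.1 i 0
    · rw [← hi]; exact h2.1 0 i
  set M' : ℝ≥0∞ := M ^ (2 * j + 2) * eexp ((j + 1) * η * h p) with hM'
  refine (lmarginal_insert_le (s := {A}) ?_ (by simpa using hAB.symm)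
    (F' := fun y => M' * (ind (y A ∈ G ∧ adj (y A) p) *
      (eexp (-(η + δ) * h (y A)) * eexp (a * h (y A))))) (fun y => ?_) _).trans ?_
  · exact (measurable_ind (hmA.inter hmB)).mul
      (((H.measurable_eexp_height _ _).const_mul _).pow_const _)
  · have hu : ∀ x, Function.update y B x (τ 0) = x := fun x => Function.update_self B x y
    simp only [hu, Function.update_self, Function.update_of_ne hAB, ind_and (_ ∧ _)]
    by_cases hyA : y A ∈ G ∧ adj (y A) p
    swap
    · rw [ind_of_false hyA]; simp
    simp only [ind_of_true hyA, one_mul]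
    -- The exponent (2j+1)η + (η+δ) splits into (j+1)η, charged to u, and (j+1)η + δ, which `hj`
    -- bounds by a - η - δ.
    refine (H.lintegral_top_le (c := (Tᶜ).card) (N := 2 * j + 1) (γ := η + δ) (s := (j + 1) * η)
      (t := h (y A)) (u := h p) hη hδ hM hMδ hyA.1 hc (by positivity) (by positivity)
      ?_).trans_eq ?_
    · push_cast; linarith
    · rw [hM', neg_mul]; ring
  refine (lmarginal_insert_le (s := ∅) ?_ (Finset.notMem_empty _)
    (F' := fun _ => M' * (M * eexp (a * h p))) (fun y => ?_) _).trans ?_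
  · exact ((measurable_ind hmA).mul ((H.measurable_eexp_height _ _).mul
      (H.measurable_eexp_height _ _))).const_mul _
  · simp only [Function.update_self]
    rw [lintegral_const_mul]
    · simp only [neg_mul]
      exact mul_le_mul' le_rfl (H.lintegral_lowest_le hδ hMδ hp)
    · have hm : Measurable fun x : E => Function.update y A x := measurable_update y
      have := ((measurable_ind hmA).mul ((H.measurable_eexp_height A (-(η + δ))).mul
        (H.measurable_eexp_height A a))).comp hm
      simpa [Function.comp_def] using this
  · rw [lmarginal_empty, hM']
    refine le_of_eq ?_
    rw [show (a + (j + 1) * η) * h p = (j + 1) * η * h p + a * h p by ring, eexp_add]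
    ring

/-- Path B–z–A–p: the lowest vertices need not be adjacent, but a shared vertex z is joined to both.
Keeping z removes one factor exp(η h(B)) and lowers the charge to u to jη; the integral over z,
governed by heights near u, brings back exp(ηu). -/
theorem lintegral_pattern_le_of_shared [SigmaFinite μ]
    (H : NeighbourBound μ adj h G a (a - η) K) (hη : 0 < η) (hηa : η < a) (hδ : 0 < δ)
    (hM : 1 ≤ M) (hMδ : K * ENNReal.ofReal (1 / δ) ≤ M)
    (hMβ : K * ENNReal.ofReal (1 / (a - η)) ≤ M) (hMη : K * ENNReal.ofReal (1 / η) ≤ M)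
    {j ℓ : ℕ} (hj : (j + 2) * η + 2 * δ ≤ a)
    (hℓ : ℓ < 2 * (j + 2)) (σ τ : Fin (j + 2) ↪ Fin ℓ)
    (hcov : ∀ i, i ∈ Set.range σ ∨ i ∈ Set.range τ) {p : E} (hp : p ∈ G) (hAB : σ 0 ≠ τ 0)
    {z : Fin ℓ} (hzσ : z ∈ Set.range σ) (hzτ : z ∈ Set.range τ) (hzA : z ≠ σ 0) (hzB : z ≠ τ 0) :
    ∫⁻ y, ind (IsOrderedClique adj h p (fun i => y (σ i)) ∧
      IsOrderedClique adj h p (fun i => y (τ i)) ∧ h (y (σ 0)) ≤ h (y (τ 0)))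
        ∂Measure.pi (fun _ => μ) ≤ M ^ (2 * j + 3) * eexp ((a + (j + 1) * η) * h p) := by
  classical
  set A := σ 0
  set B := τ 0
  set T : Finset (Fin ℓ) := {B, z, A} with hT
  have hc : (Tᶜ).card ≤ 2 * j := by
    rw [Finset.card_compl, Fintype.card_fin, hT, Finset.card_eq_three.2
      ⟨B, z, A, hzB.symm, hAB.symm, hzA, rfl⟩]; omega
  have hmA : MeasurableSet {y : Fin ℓ → E | y A ∈ G ∧ adj (y A) p} :=
    (H.measurableSet_mem_apply _).inter (H.measurableSet_adj_const _ _)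
  have hmz : MeasurableSet {y : Fin ℓ → E | y z ∈ G ∧ adj (y z) (y A) ∧ h (y z) ≤ h p} :=
    (H.measurableSet_mem_apply _).inter ((H.measurableSet_adj_apply _ _).inter
      (measurableSet_le (H.measurable_height_apply _) measurable_const))
  have hmB : MeasurableSet {y : Fin ℓ → E | y B ∈ G ∧ adj (y B) (y z) ∧ h (y B) ≤ h p ∧
      h (y A) ≤ h (y B)} :=
    (H.measurableSet_mem_apply _).inter ((H.measurableSet_adj_apply _ _).inter
      ((measurableSet_le (H.measurable_height_apply _) measurable_const).inter
        (measurableSet_le (H.measurable_height_apply _) (H.measurable_height_apply _))))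
  refine (H.lintegral_pattern_le_lmarginal hη hηa hMβ σ τ hcov p T (by simp [hT, A]) (by simp [hT, B])
    (fun y => ((y A ∈ G ∧ adj (y A) p) ∧ (y z ∈ G ∧ adj (y z) (y A) ∧ h (y z) ≤ h p)) ∧
      (y B ∈ G ∧ adj (y B) (y z) ∧ h (y B) ≤ h p ∧ h (y A) ≤ h (y B)))
    ((hmA.inter hmz).inter hmB) ?_ ?_ ?_ (fun _ => p)).trans ?_
  · intro i hi y x
    have hne : A ≠ i := fun he => hi (by simp [hT, he])
    have hne' : B ≠ i := fun he => hi (by simp [hT, he])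
    have hne2 : z ≠ i := fun he => hi (by simp [hT, he])
    simp only [Function.update_of_ne hne, Function.update_of_ne hne', Function.update_of_ne hne2]
  · intro y hy
    exact ⟨hy.1.1.1, hy.2.1, hy.2.2.2.2⟩
  · intro y hG h1 h2 h3
    obtain ⟨i, hi⟩ := hzσ
    obtain ⟨i', hi'⟩ := hzτ
    refine ⟨⟨⟨hG _, h1.2.1 0⟩, hG _, ?_, ?_⟩, hG _, ?_, h2.2.2.2 0, h3⟩
    · rw [← hi]; exact h1.1 i 0
    · rw [← hi]; exact h1.2.2.2 i
    · rw [← hi']; exact h2.1 0 i'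
  set M' : ℝ≥0∞ := M ^ (2 * j + 1) * eexp (j * η * h p) with hM'
  refine (lmarginal_insert_le (s := {z, A}) ?_ (by simp [hAB.symm, hzB.symm])
    (F' := fun y => M' * ((ind (y A ∈ G ∧ adj (y A) p) * eexp (-(η + δ) * h (y A))) *
      (ind (y z ∈ G ∧ adj (y z) (y A) ∧ h (y z) ≤ h p) * eexp (a * h (y z))))) (fun y => ?_) _).trans ?_
  · exact (measurable_ind ((hmA.inter hmz).inter hmB)).mul
      (((H.measurable_eexp_height _ _).const_mul _).pow_const _)
  · have hu : ∀ x, Function.update y B x (τ 0) = x := fun x => Function.update_self B x y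
    simp only [hu, Function.update_self, Function.update_of_ne hAB, Function.update_of_ne hzB,
      ind_and (_ ∧ _)]
    by_cases hyA : y A ∈ G ∧ adj (y A) p
    swap
    · rw [ind_of_false hyA]; simp
    by_cases hyz : y z ∈ G ∧ adj (y z) (y A) ∧ h (y z) ≤ h p
    swap
    · rw [ind_of_false hyz]; simp
    simp only [ind_of_true hyA, ind_of_true hyz, one_mul]
    refine (H.lintegral_top_le (c := (Tᶜ).card) (N := 2 * j) (γ := η + δ) (s := j * η)
      (t := h (y A)) (u := h p) hη hδ hM hMδ hyz.1 hc (by positivity) (by positivity)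
      ?_).trans_eq ?_
    · push_cast; linarith
    · rw [hM', neg_mul]; ring
  set M'' : ℝ≥0∞ := M' * (M * eexp (η * h p)) with hM''
  refine (lmarginal_insert_le (s := {A}) ?_ (by simp [hzA])
    (F' := fun y => M'' * (ind (y A ∈ G ∧ adj (y A) p) *
      (eexp (-(η + δ) * h (y A)) * eexp (a * h (y A))))) (fun y => ?_) _).trans ?_
  · exact (((measurable_ind hmA).mul (H.measurable_eexp_height _ _)).mul
      ((measurable_ind hmz).mul (H.measurable_eexp_height _ _))).const_mul _
  · simp only [Function.update_self, Function.update_of_ne hzA.symm]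
    by_cases hyA : y A ∈ G ∧ adj (y A) p
    swap
    · rw [ind_of_false hyA]; simp
    simp only [ind_of_true hyA, one_mul]
    have hm : Measurable fun x : E => ind (x ∈ G ∧ adj x (y A) ∧ h x ≤ h p) * eexp (a * h x) := by
      have hu : Measurable fun x : E => Function.update y z x := measurable_update y
      have := ((measurable_ind hmz).mul (H.measurable_eexp_height z a)).comp hu
      simpa [Function.comp_def, Function.update_of_ne hzA.symm] using this
    rw [lintegral_const_mul _ (hm.const_mul _), lintegral_const_mul _ hm]
    calc _ ≤ M' * (eexp (-(η + δ) * h (y A)) * (M * eexp (η * h p) * eexp (a * h (y A)))) := by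
          gcongr
          exact H.lintegral_shared_le hη hMη hyA.1
      _ = _ := by rw [hM'']; ring
  refine (lmarginal_insert_le (s := ∅) ?_ (Finset.notMem_empty _)
    (F' := fun _ => M'' * (M * eexp (a * h p))) (fun y => ?_) _).trans ?_
  · exact ((measurable_ind hmA).mul ((H.measurable_eexp_height _ _).mul
      (H.measurable_eexp_height _ _))).const_mul _
  · simp only [Function.update_self]
    rw [lintegral_const_mul]
    · simp only [neg_mul]
      exact mul_le_mul' le_rfl (H.lintegral_lowest_le hδ hMδ hp)
    · have hm : Measurable fun x : E => Function.update y A x := measurable_update y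
      have := ((measurable_ind hmA).mul ((H.measurable_eexp_height A (-(η + δ))).mul
        (H.measurable_eexp_height A a))).comp hm
      simpa [Function.comp_def] using this
  · rw [lmarginal_empty, hM'', hM']
    refine le_of_eq ?_
    rw [show (a + (j + 1) * η) * h p = j * η * h p + η * h p + a * h p by ring, eexp_add, eexp_add]
    ring

/-- The expected number of pairs of cliques at `p` with a prescribed overlap, the lowest vertex of
the first clique being at most as high as that of the second. -/
theorem lintegral_ordered_pattern_le [SigmaFinite μ]
    (H : NeighbourBound μ adj h G a (a - η) K) (hη : 0 < η) (hηa : η < a) (hδ : 0 < δ)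
    (hM : 1 ≤ M) (hMδ : K * ENNReal.ofReal (1 / δ) ≤ M)
    (hMβ : K * ENNReal.ofReal (1 / (a - η)) ≤ M) (hMη : K * ENNReal.ofReal (1 / η) ≤ M)
    {j ℓ : ℕ} (hj : (j + 2) * η + 2 * δ ≤ a)
    (hℓ : ℓ < 2 * (j + 2)) (σ τ : Fin (j + 2) ↪ Fin ℓ)
    (hcov : ∀ i, i ∈ Set.range σ ∨ i ∈ Set.range τ) {p : E} (hp : p ∈ G) :
    ∫⁻ y, ind (IsOrderedClique adj h p (fun i => y (σ i)) ∧
      IsOrderedClique adj h p (fun i => y (τ i)) ∧ h (y (σ 0)) ≤ h (y (τ 0)))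
        ∂Measure.pi (fun _ => μ) ≤ M ^ (2 * j + 3) * eexp ((a + (j + 1) * η) * h p) := by
  by_cases hAB : σ 0 = τ 0
  · exact H.lintegral_pattern_le_of_eq hη hηa hδ hM hMδ hMβ hj hℓ σ τ hcov hp hAB
  by_cases hadj : τ 0 ∈ Set.range σ ∨ σ 0 ∈ Set.range τ
  · exact H.lintegral_pattern_le_of_adj hη hηa hδ hM hMδ hMβ hj hℓ σ τ hcov hp hAB hadj
  -- Disjoint ranges would need 2(j+2) > ℓ indices. The shared z is not a lowest vertex, since
  -- otherwise `hadj` would hold.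
  obtain ⟨z, hzσ, hzτ⟩ : ∃ z, z ∈ Set.range σ ∧ z ∈ Set.range τ := by
    by_contra! hc
    have hinj : Function.Injective (Sum.elim σ τ) :=
      σ.injective.sumElim τ.injective fun i i' he => hc (σ i) ⟨i, rfl⟩ ⟨i', he.symm⟩
    have := Fintype.card_le_of_injective _ hinj
    simp at this
    omega
  rw [not_or] at hadj
  exact H.lintegral_pattern_le_of_shared hη hηa hδ hM hMδ hMβ hMη hj hℓ σ τ hcov hp hAB hzσ hzτ
    (fun he => hadj.2 (he ▸ hzτ)) (fun he => hadj.1 (he ▸ hzσ))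

/-- The factor 2 accounts for which of the two cliques has the lower lowest vertex. -/
theorem lintegral_pattern_le [SigmaFinite μ]
    (H : NeighbourBound μ adj h G a (a - η) K) (hη : 0 < η) (hηa : η < a) (hδ : 0 < δ)
    (hM : 1 ≤ M) (hMδ : K * ENNReal.ofReal (1 / δ) ≤ M)
    (hMβ : K * ENNReal.ofReal (1 / (a - η)) ≤ M) (hMη : K * ENNReal.ofReal (1 / η) ≤ M)
    {j ℓ : ℕ} (hj : (j + 2) * η + 2 * δ ≤ a)
    (hℓ : ℓ < 2 * (j + 2)) (σ τ : Fin (j + 2) ↪ Fin ℓ)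
    (hcov : ∀ i, i ∈ Set.range σ ∨ i ∈ Set.range τ) {p : E} (hp : p ∈ G) :
    ∫⁻ y, ind (IsOrderedClique adj h p (fun i => y (σ i))) *
      ind (IsOrderedClique adj h p (fun i => y (τ i))) ∂Measure.pi (fun _ => μ) ≤
        2 * M ^ (2 * j + 3) * eexp ((a + (j + 1) * η) * h p) := by
  have hm : ∀ ρ : Fin (j + 2) ↪ Fin ℓ,
      MeasurableSet {y : Fin ℓ → E | IsOrderedClique adj h p (fun i => y (ρ i))} := fun ρ => by
    have hf : Measurable fun (y : Fin ℓ → E) (i : Fin (j + 2)) => y (ρ i) := by fun_prop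
    exact hf (H.measurableSet_isOrderedClique p)
  have h1 := H.lintegral_ordered_pattern_le hη hηa hδ hM hMδ hMβ hMη hj hℓ σ τ hcov hp
  have h2 := H.lintegral_ordered_pattern_le hη hηa hδ hM hMδ hMβ hMη hj hℓ τ σ
    (fun i => (hcov i).symm) hp
  calc _ ≤ ∫⁻ y, ind (IsOrderedClique adj h p (fun i => y (σ i)) ∧
        IsOrderedClique adj h p (fun i => y (τ i)) ∧ h (y (σ 0)) ≤ h (y (τ 0))) +
        ind (IsOrderedClique adj h p (fun i => y (τ i)) ∧
        IsOrderedClique adj h p (fun i => y (σ i)) ∧ h (y (τ 0)) ≤ h (y (σ 0)))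
        ∂Measure.pi (fun _ => μ) := by
        refine lintegral_mono fun y => ?_
        rw [← ind_and]
        rcases le_total (h (y (σ 0))) (h (y (τ 0))) with hle | hle
        · exact (ind_mono fun hc => ⟨hc.1, hc.2, hle⟩).trans le_self_add
        · exact (ind_mono fun hc => ⟨hc.2, hc.1, hle⟩).trans le_add_self
    _ ≤ _ := by
        rw [lintegral_add_left]
        · refine (add_le_add h1 h2).trans_eq (by ring)
        · exact measurable_ind ((hm σ).inter ((hm τ).inter
            (measurableSet_le (H.measurable_height_apply _) (H.measurable_height_apply _))))

end NeighbourBound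

/-! ### Poisson factorial moments and overlap patterns. -/

theorem lintegral_poissonMeasure (r : NNReal) (f : ℕ → ℝ≥0∞) :
    ∫⁻ j, f j ∂poissonMeasure r =
      ∑' j, f j * ENNReal.ofReal (Real.exp (-r) * r ^ j / j.factorial) := by
  simp_rw [lintegral_countable', poissonMeasure_singleton]

/-- The factorial moments of the Poisson distribution. -/
theorem lintegral_descFactorial_poissonMeasure (r : NNReal) (k : ℕ) :
    ∫⁻ j, (j.descFactorial k : ℝ≥0∞) ∂poissonMeasure r = (r : ℝ≥0∞) ^ k := by
  have h1 : ∑' i : ℕ, ENNReal.ofReal (Real.exp (-r) * r ^ i / i.factorial) = 1 := by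
    have := lintegral_poissonMeasure r 1
    simpa using this.symm
  -- The terms below k vanish; shifting the index by k recovers r^k times the Poisson weights.
  rw [lintegral_poissonMeasure, ← (add_left_injective k).tsum_eq]
  · calc _ = ∑' i : ℕ, (r : ℝ≥0∞) ^ k * ENNReal.ofReal (Real.exp (-r) * r ^ i / i.factorial) := by
          refine tsum_congr fun i => ?_
          have h2 := Nat.factorial_mul_descFactorial (Nat.le_add_left k i)
          rw [Nat.add_sub_cancel] at h2
          rw [← ENNReal.ofReal_natCast, ← ENNReal.ofReal_mul (by positivity),
            ← ENNReal.ofReal_coe_nnreal, ← ENNReal.ofReal_pow (by positivity),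
            ← ENNReal.ofReal_mul (by positivity), ← h2]
          congr 1
          have : ((i + k).descFactorial k : ℝ) ≠ 0 := by
            rw [Nat.cast_ne_zero]
            exact (Nat.descFactorial_pos.2 (Nat.le_add_left k i)).ne'
          have : (i.factorial : ℝ) ≠ 0 := by positivity
          push_cast
          field_simp
          ring
      _ = _ := by rw [ENNReal.tsum_mul_left, h1, mul_one]
  · intro j hj
    by_contra hc
    have hjk : j < k := by
      by_contra hjk
      exact hc ⟨j - k, by simp only; omega⟩
    exact hj (by simp [Nat.descFactorial_of_lt hjk])

/-- An overlap pattern of two `k`-tuples with `ℓ < 2 k` different entries in total. -/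
abbrev OverlapPattern (k : ℕ) : Type :=
  Σ ℓ : Fin (2 * k), {στ : (Fin k ↪ Fin ℓ) × (Fin k ↪ Fin ℓ) //
    ∀ i, i ∈ Set.range στ.1 ∨ i ∈ Set.range στ.2}

noncomputable instance (k : ℕ) : Fintype (OverlapPattern k) := by
  classical infer_instance

/-- The union of the two ranges is numbered by `Fin ℓ`; a common element forces ℓ < 2k. -/
theorem exists_overlapPattern {k j : ℕ} (I J : Fin k ↪ Fin j)
    (h : ¬ Disjoint (Set.range I) (Set.range J)) :
    ∃ (π : OverlapPattern k) (L : Fin π.1 ↪ Fin j),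
      I = π.2.1.1.trans L ∧ J = π.2.1.2.trans L := by
  classical
  set A : Finset (Fin j) := Finset.univ.map I
  set B : Finset (Fin j) := Finset.univ.map J
  set S : Finset (Fin j) := A ∪ B with hS
  have hI : ∀ i, I i ∈ S := fun i => by simp [hS, A]
  have hJ : ∀ i, J i ∈ S := fun i => by simp [hS, B]
  have hcard : S.card < 2 * k := by
    rw [hS]
    have h1 := Finset.card_union_add_card_inter A B
    have hA : A.card = k := by simp [A]
    have hB : B.card = k := by simp [B]
    have h2 : 0 < (A ∩ B).card := by
      rw [Finset.card_pos]
      obtain ⟨x, hx1, hx2⟩ := Set.not_disjoint_iff.1 h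
      exact ⟨x, by simpa [A, B] using ⟨hx1, hx2⟩⟩
    omega
  let e := S.equivFin
  let L : Fin S.card ↪ Fin j := e.symm.toEmbedding.trans (Function.Embedding.subtype _)
  let σ : Fin k ↪ Fin S.card := ⟨fun i => e ⟨I i, hI i⟩, fun i i' h => by simpa using h⟩
  let τ : Fin k ↪ Fin S.card := ⟨fun i => e ⟨J i, hJ i⟩, fun i i' h => by simpa using h⟩
  refine ⟨⟨⟨S.card, hcard⟩, ⟨(σ, τ), fun i => ?_⟩⟩, L, ?_, ?_⟩
  · have hi : (e.symm i : Fin j) ∈ A ∪ B := (e.symm i).2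
    rw [Finset.mem_union] at hi
    rcases hi with hi | hi
    · obtain ⟨a, -, ha⟩ := Finset.mem_map.1 hi
      refine Or.inl ⟨a, ?_⟩
      change e ⟨I a, hI a⟩ = i
      rw [← e.eq_symm_apply]
      exact Subtype.ext ha
    · obtain ⟨a, -, ha⟩ := Finset.mem_map.1 hi
      refine Or.inr ⟨a, ?_⟩
      change e ⟨J a, hJ a⟩ = i
      rw [← e.eq_symm_apply]
      exact Subtype.ext ha
  · refine Function.Embedding.ext fun i => ?_
    change I i = e.symm (e ⟨I i, hI i⟩)
    rw [e.symm_apply_apply]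
  · refine Function.Embedding.ext fun i => ?_
    change J i = e.symm (e ⟨J i, hJ i⟩)
    rw [e.symm_apply_apply]

/-- A pair is recovered from its pattern and numbering, so the chosen map is injective. Different
numberings count a pair repeatedly on the right, which is harmless for an upper bound. -/
theorem sum_overlapping_le {k j : ℕ} (Φ : (Fin k ↪ Fin j) → (Fin k ↪ Fin j) → ℝ≥0∞)
    (s : Finset ((Fin k ↪ Fin j) × (Fin k ↪ Fin j)))
    (hs : ∀ p ∈ s, ¬ Disjoint (Set.range p.1) (Set.range p.2)) :
    ∑ p ∈ s, Φ p.1 p.2 ≤ ∑ π : OverlapPattern k, ∑ L : Fin π.1 ↪ Fin j,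
      Φ (π.2.1.1.trans L) (π.2.1.2.trans L) := by
  classical
  let Ψ : (Σ π : OverlapPattern k, Fin π.1 ↪ Fin j) → ℝ≥0∞ :=
    fun x => Φ (x.1.2.1.1.trans x.2) (x.1.2.1.2.trans x.2)
  have hex : ∀ p : s, ∃ x : Σ π : OverlapPattern k, Fin π.1 ↪ Fin j,
      p.1.1 = x.1.2.1.1.trans x.2 ∧ p.1.2 = x.1.2.1.2.trans x.2 := fun p => by
    obtain ⟨π, L, h1, h2⟩ := exists_overlapPattern p.1.1 p.1.2 (hs p.1 p.2)
    exact ⟨⟨π, L⟩, h1, h2⟩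
  choose e he1 he2 using hex
  have hinj : Function.Injective e := fun p p' h =>
    Subtype.ext (Prod.ext (by rw [he1, he1, h]) (by rw [he2, he2, h]))
  calc ∑ p ∈ s, Φ p.1 p.2 = ∑ p : s, Ψ (e p) := by
        rw [← Finset.sum_coe_sort]
        exact Finset.sum_congr rfl fun p _ => by rw [he1, he2]
    _ = ∑ x ∈ Finset.univ.map ⟨e, hinj⟩, Ψ x := by rw [Finset.sum_map]; rfl
    _ ≤ ∑ x, Ψ x := Finset.sum_le_sum_of_subset (Finset.subset_univ _)
    _ = _ := by rw [← Finset.univ_sigma_univ, Finset.sum_sigma]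

/-- The number of `k`-tuples of distinct elements among `x 0, …, x (j - 1)` that satisfy `Q`. -/
noncomputable def tupleCount {E : Type*} {k : ℕ} (Q : (Fin k → E) → Prop) (j : ℕ) (x : ℕ → E) :
    ℝ≥0∞ :=
  ∑ I : Fin k ↪ Fin j, ind (Q fun i => x (I i))

/-- The part of the square of `tupleCount` that comes from pairs of disjoint tuples. -/
noncomputable def disjointPairCount {E : Type*} {k : ℕ} (Q : (Fin k → E) → Prop) (j : ℕ)
    (x : ℕ → E) : ℝ≥0∞ :=
  ∑ L : Fin k ⊕ Fin k ↪ Fin j,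
    ind (Q fun i => x (L (Sum.inl i))) * ind (Q fun i => x (L (Sum.inr i)))

/-- An upper bound for the part of the square of `tupleCount` that comes from overlapping pairs. -/
noncomputable def overlapCount {E : Type*} {k : ℕ} (Q : (Fin k → E) → Prop) (j : ℕ)
    (x : ℕ → E) : ℝ≥0∞ :=
  ∑ π : OverlapPattern k, ∑ L : Fin π.1 ↪ Fin j,
    ind (Q fun i => x (L (π.2.1.1 i))) * ind (Q fun i => x (L (π.2.1.2 i)))

theorem sq_tupleCount_le {E : Type*} {k : ℕ} (Q : (Fin k → E) → Prop) (j : ℕ) (x : ℕ → E) :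
    tupleCount Q j x ^ 2 ≤ disjointPairCount Q j x + overlapCount Q j x := by
  classical
  set Φ : (Fin k ↪ Fin j) → (Fin k ↪ Fin j) → ℝ≥0∞ := fun I J =>
    ind (Q fun i => x (I i)) * ind (Q fun i => x (J i)) with hΦ
  have h1 : tupleCount Q j x ^ 2 = ∑ p : (Fin k ↪ Fin j) × (Fin k ↪ Fin j), Φ p.1 p.2 := by
    rw [tupleCount, sq, Finset.sum_mul_sum, Fintype.sum_prod_type]
  have h2 : disjointPairCount Q j x = ∑ p : (Fin k ↪ Fin j) × (Fin k ↪ Fin j) with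
      Disjoint (Set.range p.1) (Set.range p.2), Φ p.1 p.2 := by
    rw [disjointPairCount, Finset.sum_subtype (p := fun p : (Fin k ↪ Fin j) × (Fin k ↪ Fin j) =>
      Disjoint (Set.range p.1) (Set.range p.2)) _ (by simp)]
    exact Fintype.sum_equiv Equiv.sumEmbeddingEquivProdEmbeddingDisjoint _ _ fun L => rfl
  rw [h1, h2, ← Finset.sum_filter_add_sum_filter_not Finset.univ
    (fun p : (Fin k ↪ Fin j) × (Fin k ↪ Fin j) => Disjoint (Set.range p.1) (Set.range p.2))]
  refine add_le_add le_rfl ?_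
  exact sum_overlapping_le Φ _ fun p hp => (Finset.mem_filter.1 hp).2

/-! ### Moments of tuple counts of a Poisson process. -/

section Expectation

variable {E Ω : Type*} [MeasurableSpace E] [MeasurableSpace Ω] {P : Measure Ω}
  [IsProbabilityMeasure P] {N : Ω → ℕ} {X : ℕ → Ω → E} {ν : Measure E} {k : ℕ}
  {Q : (Fin k → E) → Prop}

theorem lintegral_tuple [IsProbabilityMeasure ν] (hX : ∀ i, Measurable (X i))
    (hν : ∀ i, P.map (X i) = ν) (hind : iIndepFun X P) {ι : Type*} [Fintype ι] (L : ι ↪ ℕ)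
    {g : (ι → E) → ℝ≥0∞} (hg : Measurable g) :
    ∫⁻ ω, g (fun i => X (L i) ω) ∂P = ∫⁻ y, g y ∂Measure.pi (fun _ => ν) := by
  have h1 := (iIndepFun_iff_map_fun_eq_pi_map (fun i => (hX (L i)).aemeasurable)).1
    (hind.precomp L.injective)
  simp only [hν] at h1
  rw [← h1, lintegral_map hg (measurable_pi_lambda _ fun i => hX (L i))]

theorem lintegral_comp_card {r : NNReal} (hN : Measurable N) (hNr : P.map N = poissonMeasure r)
    (hX : ∀ i, Measurable (X i)) (hNX : IndepFun N (fun ω i => X i ω) P)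
    {F : ℕ → (ℕ → E) → ℝ≥0∞} (hF : ∀ j, Measurable (F j)) :
    ∫⁻ ω, F (N ω) (fun i => X i ω) ∂P = ∫⁻ j, ∫⁻ ω, F j (fun i => X i ω) ∂P ∂poissonMeasure r := by
  have hXm : Measurable fun ω i => X i ω := measurable_pi_lambda _ hX
  have hFm : Measurable fun z : ℕ × (ℕ → E) => F z.1 z.2 :=
    measurable_from_prod_countable_right hF
  have h1 := (indepFun_iff_map_prod_eq_prod_map_map hN.aemeasurable hXm.aemeasurable).1 hNX
  have h2 := lintegral_map (μ := P) hFm (hN.prodMk hXm)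
  rw [h1, lintegral_prod _ hFm.aemeasurable, hNr] at h2
  rw [← h2]
  exact lintegral_congr fun j => lintegral_map (hF j) hXm

theorem measurable_ind_tuple (hQ : MeasurableSet {y | Q y}) {ι : Type*} (L : Fin k → ι) :
    Measurable fun x : ι → E => ind (Q fun i => x (L i)) :=
  (measurable_ind hQ).comp (f := fun (x : ι → E) i => x (L i)) (by fun_prop)

theorem measurable_tupleCount (hQ : MeasurableSet {y | Q y}) (j : ℕ) :
    Measurable (tupleCount Q j) :=
  Finset.measurable_sum _ fun I _ => measurable_ind_tuple hQ fun i => (I i : ℕ)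

theorem measurable_disjointPairCount (hQ : MeasurableSet {y | Q y}) (j : ℕ) :
    Measurable (disjointPairCount Q j) :=
  Finset.measurable_sum _ fun L _ => (measurable_ind_tuple hQ fun i => (L (Sum.inl i) : ℕ)).mul
    (measurable_ind_tuple hQ fun i => (L (Sum.inr i) : ℕ))

/-- The multivariate Mecke formula for a function of `ι`-tuples of distinct points of a Poisson
process. -/
theorem lintegral_sum_embedding [IsProbabilityMeasure ν] {r : NNReal} (hN : Measurable N)
    (hNr : P.map N = poissonMeasure r) (hX : ∀ i, Measurable (X i)) (hν : ∀ i, P.map (X i) = ν)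
    (hind : iIndepFun X P) (hNX : IndepFun N (fun ω i => X i ω) P) {ι : Type*} [Fintype ι]
    [DecidableEq ι] {g : (ι → E) → ℝ≥0∞} (hg : Measurable g) :
    ∫⁻ ω, ∑ L : ι ↪ Fin (N ω), g (fun i => X (L i) ω) ∂P =
      (r : ℝ≥0∞) ^ Fintype.card ι * ∫⁻ y, g y ∂Measure.pi (fun _ => ν) := by
  have hm : ∀ (j : ℕ) (L : ι ↪ Fin j), Measurable fun x : ℕ → E => g fun i => x (L i) :=
    fun j L => hg.comp (f := fun (x : ℕ → E) i => x (L i)) (by fun_prop)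
  rw [lintegral_comp_card (F := fun j x => ∑ L : ι ↪ Fin j, g fun i => x (L i)) hN hNr hX hNX
    fun j => Finset.measurable_sum _ fun L _ => hm j L]
  -- Given N = j there are j(j-1)⋯(j-|ι|+1) embeddings, all with the same expectation.
  rw [← lintegral_descFactorial_poissonMeasure, ← lintegral_mul_const _ .of_discrete]
  refine lintegral_congr fun j => ?_
  refine (lintegral_finsetSum _ fun L _ => ?_).trans ?_
  · exact (hm j L).comp (measurable_pi_lambda (fun ω i => X i ω) hX)
  have h1 : ∀ L : ι ↪ Fin j, ∫⁻ ω, g (fun i => X (L i) ω) ∂P = ∫⁻ y, g y ∂Measure.pi (fun _ => ν) :=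
    fun L => lintegral_tuple hX hν hind (L.trans Fin.valEmbedding) hg
  simp only [h1, Finset.sum_const, Finset.card_univ, Fintype.card_embedding_eq, Fintype.card_fin,
    nsmul_eq_mul]

/-- Moves the power of r in the Mecke formula into the intensity measure, to which the neighbour
bound refers. -/
theorem lintegral_pi_smul [SigmaFinite ν] {ι : Type*} [Fintype ι] (r : NNReal)
    (g : (ι → E) → ℝ≥0∞) :
    ∫⁻ y, g y ∂Measure.pi (fun _ => r • ν) =
      (r : ℝ≥0∞) ^ Fintype.card ι * ∫⁻ y, g y ∂Measure.pi (fun _ : ι => ν) := by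
  have h1 : Measure.pi (fun _ : ι => r • ν) =
      ((r : ℝ≥0∞) ^ Fintype.card ι) • Measure.pi (fun _ : ι => ν) := by
    refine Measure.pi_eq fun s hs => ?_
    rw [Measure.smul_apply, Measure.pi_pi]
    have h2 : ∀ i, (r • ν) (s i) = (r : ℝ≥0∞) * ν (s i) := fun i => rfl
    simp only [h2, Finset.prod_mul_distrib, Finset.prod_const, Finset.card_univ, smul_eq_mul]
  rw [h1, lintegral_smul_measure, smul_eq_mul]

end Expectation

theorem tupleCount_ne_top {E : Type*} {k : ℕ} (Q : (Fin k → E) → Prop) (j : ℕ) (x : ℕ → E) : tupleCount Q j x ≠ ⊤ :=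
  ENNReal.sum_ne_top.2 fun _ _ => ((ind_le_one _).trans_lt ENNReal.one_lt_top).ne

theorem ncard_tuples_eq {E : Type*} {k : ℕ} (Q : (Fin k → E) → Prop) {j : ℕ} {x : ℕ → E} (hx : Function.Injective x) :
    ((Set.ncard {Y : Fin k → E | (∀ i, Y i ∈ {z | ∃ i < j, x i = z}) ∧ Function.Injective Y ∧ Q Y} :
      ℕ) : ℝ) = (tupleCount Q j x).toReal := by
  classical
  have h1 : {Y : Fin k → E | (∀ i, Y i ∈ {z | ∃ i < j, x i = z}) ∧ Function.Injective Y ∧ Q Y} =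
      (fun (I : Fin k ↪ Fin j) i => x (I i)) ''
        ↑(Finset.univ.filter fun I : Fin k ↪ Fin j => Q fun i => x (I i)) := by
    ext Y
    constructor
    · rintro ⟨h1, h2, h3⟩
      choose I hI using h1
      have hI' : ∀ i, x (I i) = Y i := fun i => (hI i).2
      refine ⟨⟨fun i => ⟨I i, (hI i).1⟩, fun i i' h => h2 ?_⟩, ?_, funext hI'⟩
      · rw [← hI', ← hI', Fin.mk.inj h]
      · have : Q fun i => x (I i) := by rwa [funext hI']
        exact Finset.mem_coe.2 (Finset.mem_filter.2 ⟨Finset.mem_univ _, this⟩)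
    · rintro ⟨I, hI, rfl⟩
      refine ⟨fun i => ⟨I i, (I i).2, rfl⟩, fun i i' h => I.injective (Fin.ext (hx h)), ?_⟩
      simpa using hI
  rw [h1, Set.ncard_image_of_injective, Set.ncard_coe_finset]
  · unfold tupleCount ind
    rw [Finset.sum_boole, ENNReal.toReal_natCast]
  · intro I J h
    refine Function.Embedding.ext fun i => Fin.ext (hx (congrFun h i))

/-! ### The variance is bounded by the overlapping pairs. -/

section Variance

variable {E Ω : Type*} [MeasurableSpace E] [MeasurableSpace Ω] {P : Measure Ω}
  [IsProbabilityMeasure P] {N : Ω → ℕ} {X : ℕ → Ω → E} {ν : Measure E} {k : ℕ}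
  {Q : (Fin k → E) → Prop}

theorem lintegral_ind_mul_ind_sum [IsProbabilityMeasure ν] (hQ : MeasurableSet {y | Q y}) :
    ∫⁻ y : Fin k ⊕ Fin k → E, ind (Q fun i => y (Sum.inl i)) * ind (Q fun i => y (Sum.inr i))
      ∂Measure.pi (fun _ => ν) = (∫⁻ y, ind (Q y) ∂Measure.pi (fun _ => ν)) ^ 2 := by
  have h := measurePreserving_sumPiEquivProdPi (fun _ : Fin k ⊕ Fin k => ν)
  have hm := measurable_ind hQ
  have h1 := h.lintegral_comp (f := fun z => ind (Q z.1) * ind (Q z.2))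
    ((hm.comp measurable_fst).mul (hm.comp measurable_snd))
  refine h1.trans ?_
  rw [lintegral_prod_mul (f := fun y => ind (Q y)) (g := fun y => ind (Q y)) hm.aemeasurable
    hm.aemeasurable, sq]

/-- The variance of the number of `k`-tuples in a Poisson process with a given property is at most
the expected number of overlapping pairs of such tuples. -/
theorem variance_tupleCount_le [IsProbabilityMeasure ν] {r : NNReal} (hN : Measurable N)
    (hNr : P.map N = poissonMeasure r) (hX : ∀ i, Measurable (X i)) (hν : ∀ i, P.map (X i) = ν)
    (hind : iIndepFun X P) (hNX : IndepFun N (fun ω i => X i ω) P) (hQ : MeasurableSet {y | Q y})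
    {B : ℝ} (hB0 : 0 ≤ B) (hB : ∀ π : OverlapPattern k,
      ∫⁻ y, ind (Q fun i => y (π.2.1.1 i)) * ind (Q fun i => y (π.2.1.2 i))
        ∂Measure.pi (fun _ => r • ν) ≤ ENNReal.ofReal B)
    {C : Ω → ℝ} (hC : ∀ᵐ ω ∂P, C ω = (tupleCount Q (N ω) fun i => X i ω).toReal) :
    MemLp C 2 P ∧ variance C P ≤ Fintype.card (OverlapPattern k) * B := by
  have hXm : Measurable fun ω i => X i ω := measurable_pi_lambda _ hX
  have hjm : ∀ {F : ℕ → (ℕ → E) → ℝ≥0∞}, (∀ j, Measurable (F j)) →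
      Measurable fun ω => F (N ω) fun i => X i ω := fun {F} hF =>
    (measurable_from_prod_countable_right (f := fun z : ℕ × (ℕ → E) => F z.1 z.2) hF).comp
      (hN.prodMk hXm)
  set S : Ω → ℝ≥0∞ := fun ω => tupleCount Q (N ω) fun i => X i ω with hS
  have hSm : Measurable S := hjm (measurable_tupleCount hQ)
  have hStop : ∀ ω, S ω ≠ ⊤ := fun ω => tupleCount_ne_top _ _ _
  set A : ℝ≥0∞ := (r : ℝ≥0∞) ^ k * ∫⁻ y, ind (Q y) ∂Measure.pi (fun _ => ν) with hA
  have hS1 : ∫⁻ ω, S ω ∂P = A := by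
    have := lintegral_sum_embedding (g := fun y => ind (Q y)) hN hNr hX hν hind hNX (measurable_ind hQ)
    rw [Fintype.card_fin] at this
    exact this
  -- Finiteness of the mean is what lets its square cancel once the bound is read in ℝ.
  have hAtop : A ≠ ⊤ := by
    refine ENNReal.mul_ne_top (by finiteness) ((lintegral_mono fun y => ind_le_one _).trans_lt ?_).ne
    simp
  have hD : ∫⁻ ω, disjointPairCount Q (N ω) (fun i => X i ω) ∂P = A ^ 2 := by
    have := lintegral_sum_embedding (g := fun y : Fin k ⊕ Fin k → E =>
      ind (Q fun i => y (Sum.inl i)) * ind (Q fun i => y (Sum.inr i))) hN hNr hX hν hind hNX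
      ((measurable_ind_tuple hQ _).mul (measurable_ind_tuple hQ _))
    rw [lintegral_ind_mul_ind_sum hQ, Fintype.card_sum, Fintype.card_fin] at this
    refine Eq.trans this ?_
    rw [hA]; ring
  have hO : ∫⁻ ω, overlapCount Q (N ω) (fun i => X i ω) ∂P ≤
      ENNReal.ofReal (Fintype.card (OverlapPattern k) * B) := by
    unfold overlapCount
    rw [lintegral_finsetSum]
    · calc _ ≤ ∑ _π : OverlapPattern k, ENNReal.ofReal B := by
            refine Finset.sum_le_sum fun π _ => ?_
            have hg : Measurable fun y : Fin π.1 → E =>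
              ind (Q fun i => y (π.2.1.1 i)) * ind (Q fun i => y (π.2.1.2 i)) :=
              (measurable_ind_tuple hQ _).mul (measurable_ind_tuple hQ _)
            have := lintegral_sum_embedding hN hNr hX hν hind hNX hg
            rw [← lintegral_pi_smul] at this
            exact this.trans_le (hB π)
        _ = _ := by
            rw [Finset.sum_const, Finset.card_univ, nsmul_eq_mul, ENNReal.ofReal_mul (by positivity),
              ENNReal.ofReal_natCast]
    · intro π _
      exact hjm (F := fun j x => ∑ L : Fin π.1 ↪ Fin j,
        ind (Q fun i => x (L (π.2.1.1 i))) * ind (Q fun i => x (L (π.2.1.2 i)))) fun j =>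
          Finset.measurable_sum _ fun L _ => (measurable_ind_tuple hQ fun i => (L (π.2.1.1 i) : ℕ)).mul
            (measurable_ind_tuple hQ fun i => (L (π.2.1.2 i) : ℕ))
  have hS2 : ∫⁻ ω, S ω ^ 2 ∂P ≤ A ^ 2 + ENNReal.ofReal (Fintype.card (OverlapPattern k) * B) := by
    calc _ ≤ ∫⁻ ω, disjointPairCount Q (N ω) (fun i => X i ω) +
          overlapCount Q (N ω) (fun i => X i ω) ∂P :=
          lintegral_mono fun ω => sq_tupleCount_le Q _ _
      _ ≤ _ := by
          rw [lintegral_add_left (hjm (measurable_disjointPairCount hQ)), hD]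
          exact add_le_add le_rfl hO
  have hS2top : ∫⁻ ω, S ω ^ 2 ∂P ≠ ⊤ :=
    (hS2.trans_lt (ENNReal.add_lt_top.2 ⟨(ENNReal.pow_ne_top hAtop).lt_top, ENNReal.ofReal_lt_top⟩)).ne
  have hC2 : C ^ 2 =ᵐ[P] fun ω => (S ω ^ 2).toReal := by
    filter_upwards [hC] with ω hω
    rw [Pi.pow_apply, hω, ENNReal.toReal_pow]
  have hCm : AEStronglyMeasurable C P :=
    (hSm.ennreal_toReal.aestronglyMeasurable).congr (hC.mono fun ω hω => hω.symm)
  have hmem : MemLp C 2 P := by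
    rw [memLp_two_iff_integrable_sq hCm]
    exact (integrable_toReal_of_lintegral_ne_top (hSm.pow_const 2).aemeasurable hS2top).congr hC2.symm
  refine ⟨hmem, ?_⟩
  rw [variance_eq_sub hmem, integral_congr_ae hC2, integral_congr_ae hC,
    integral_toReal (hSm.pow_const 2).aemeasurable
      (Filter.Eventually.of_forall fun ω => (ENNReal.pow_ne_top (hStop ω)).lt_top),
    integral_toReal hSm.aemeasurable (Filter.Eventually.of_forall fun ω => (hStop ω).lt_top), hS1]
  have h3 := ENNReal.toReal_mono (by finiteness) hS2
  rw [ENNReal.toReal_add (ENNReal.pow_ne_top hAtop) ENNReal.ofReal_ne_top, ENNReal.toReal_pow,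
    ENNReal.toReal_ofReal (by positivity)] at h3
  linarith

theorem ae_pairwise_ne [MeasurableEq E] [IsProbabilityMeasure ν] (hX : ∀ i, Measurable (X i)) (hν : ∀ i, P.map (X i) = ν)
    (hind : iIndepFun X P) (hatom : ∀ x, ν {x} = 0) :
    ∀ᵐ ω ∂P, Function.Injective fun i => X i ω := by
  have key : ∀ i j, i ≠ j → ∀ᵐ ω ∂P, X i ω ≠ X j ω := fun i j hij => by
    have h1 := (indepFun_iff_map_prod_eq_prod_map_map (hX i).aemeasurable
      (hX j).aemeasurable).1 (hind.indepFun hij)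
    rw [hν, hν] at h1
    have hd : MeasurableSet (Set.diagonal E) := measurableSet_diagonal
    have h2 : (ν.prod ν) (Set.diagonal E) = 0 := by
      rw [Measure.measure_prod_null hd]
      refine Filter.Eventually.of_forall fun x => ?_
      have : Prod.mk x ⁻¹' Set.diagonal E = {x} := by
        ext y; simp [eq_comm]
      exact (congrArg ν this).trans (hatom x)
    rw [← h1, Measure.map_apply ((hX i).prodMk (hX j)) hd] at h2
    rw [ae_iff]
    refine measure_mono_null (fun ω hω => ?_) h2
    simpa using hω
  have h3 : ∀ᵐ ω ∂P, ∀ i j, i ≠ j → X i ω ≠ X j ω := by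
    simp only [ae_all_iff]
    exact key
  filter_upwards [h3] with ω hω i j hij
  by_contra hne
  exact hω i j hne hij

end Variance

/-! ### The hyperbolic model and the choice of parameters. -/

theorem cast_add_two_sub_one (n : ℕ) : ((n + 2 : ℕ) : ℝ) - 1 = n + 1 := by push_cast; ring

theorem exp_mul_radius (n : ℕ) {N : ℕ} (hN : 1 ≤ N) :
    Real.exp ((n + 1) / 2 * radius (n + 2) N) = N := by
  have hN0 : (0 : ℝ) < N := by exact_mod_cast hN
  unfold radius
  rw [cast_add_two_sub_one, ← mul_assoc, div_mul_div_comm, mul_comm ((n : ℝ) + 1) 2, div_self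
    (by positivity), one_mul, Real.exp_log hN0]

theorem radius_mono (n : ℕ) {N N' : ℕ} (hN : 1 ≤ N) (h : N ≤ N') :
    radius (n + 2) N ≤ radius (n + 2) N' := by
  have hN0 : (0 : ℝ) < N := by exact_mod_cast hN
  have : (N : ℝ) ≤ N' := by exact_mod_cast h
  unfold radius
  rw [cast_add_two_sub_one]
  gcongr

theorem radius_two_pos (n : ℕ) : 0 < radius (n + 2) 2 := by
  unfold radius
  rw [cast_add_two_sub_one]
  have : 0 < Real.log ((2 : ℕ) : ℝ) := Real.log_pos (by norm_num)
  positivity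

/-- A sequence tending to infinity is bounded below, whatever its finitely many exceptional values
are. -/
theorem exists_le_omega (n : ℕ) : ∃ b : ℝ, ∀ N, b ≤ omega (n + 2) N := by
  have h1 : Filter.Tendsto (radius (n + 2)) Filter.atTop Filter.atTop := by
    unfold radius
    rw [cast_add_two_sub_one]
    exact (Real.tendsto_log_atTop.comp tendsto_natCast_atTop_atTop).const_mul_atTop (by positivity)
  have h2 : Filter.Tendsto (omega (n + 2)) Filter.atTop Filter.atTop :=
    Real.tendsto_log_atTop.comp (Filter.tendsto_abs_atTop_atTop.comp (Real.tendsto_log_atTop.comp h1))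
  obtain ⟨b, hb⟩ := Filter.bddBelow_range_of_tendsto_atTop_atTop h2
  exact ⟨b, fun N => hb ⟨N, rfl⟩⟩

/-- The points of the hyperbolic ball of radius `R` about the origin. -/
def hypBall (d : ℕ) (R : ℝ) : Set (EuclideanSpace ℝ (Fin d)) := {x | ‖x‖ < 1 ∧ dH 0 x ≤ R}

theorem exists_neighbourBound (n : ℕ) {α : ℝ} (hα : 0 < α) : ∃ C : ℝ, 0 < C ∧ ∀ N : ℕ, 2 ≤ N →
    NeighbourBound ((N : NNReal) • vertexLaw (n + 2) α (radius (n + 2) N))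
      (fun x y => dH x y ≤ radius (n + 2) N) (fun x => radius (n + 2) N - dH 0 x)
      (hypBall (n + 2) (radius (n + 2) N)) ((n + 1) / 2) ((n + 1) / 2 - (n + 1) * (1 - α))
      (ENNReal.ofReal C) := by
  obtain ⟨C, hC, h⟩ := exists_lintegral_neighbours_le n hα (radius_two_pos n)
  refine ⟨C, hC, fun N hN => ?_⟩
  set R := radius (n + 2) N
  have hm := measurable_dH_right (0 : EuclideanSpace ℝ (Fin (n + 2)))
  refine ⟨measurableSet_le (measurable_dH _) measurable_const, measurable_const.sub hm,
    (measurableSet_lt measurable_norm measurable_const).inter (measurableSet_le hm measurable_const),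
    Measure.ae_smul_measure (ae_vertexLaw n α R) _, fun x hx => by linarith [hx.2], ?_⟩
  intro w hw φ hφ
  have h1 := h R (radius_mono n one_le_two hN) w hw.1 hw.2 φ hφ
  rw [lintegral_smul_measure]
  have h2 : ∀ x, ind (dH x w ≤ R) * φ (R - dH 0 x) =
      {x | dH x w ≤ R}.indicator (fun x => φ (R - dH 0 x)) x := fun x => by
    by_cases hx : dH x w ≤ R
    · rw [ind_of_true hx, Set.indicator_of_mem (by exact hx), one_mul]
    · rw [ind_of_false hx, Set.indicator_of_notMem (by exact hx), zero_mul]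
  simp only [h2]
  calc _ ≤ (N : ℝ≥0∞) * (ENNReal.ofReal (C * Real.exp (-((n + 1) / 2 * dH 0 w))) *
          ∫⁻ t in Set.Icc 0 R, φ t * ENNReal.ofReal (Real.exp ((n + 1) * (1 / 2 - α) * t))) := by
        refine le_trans (le_of_eq ?_) (mul_le_mul' le_rfl h1)
        simp [ENNReal.smul_def]
    _ ≤ (N : ℝ≥0∞) * (ENNReal.ofReal (C * Real.exp (-((n + 1) / 2 * dH 0 w))) *
          ∫⁻ t in Set.Ici 0, φ t * eexp (-(((n + 1) / 2 - (n + 1) * (1 - α)) * t))) := by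
        refine mul_le_mul' le_rfl (mul_le_mul' le_rfl ?_)
        refine (lintegral_mono_set Set.Icc_subset_Ici_self).trans_eq (lintegral_congr fun t => ?_)
        unfold eexp
        congr 3; ring
    _ = _ := by
        rw [← mul_assoc]
        congr 1
        unfold eexp
        -- Since N = exp(aR), the intensity turns exp(-a d_H(o, w)) into exp(a h(w)).
        rw [← ENNReal.ofReal_natCast, ← exp_mul_radius n (by omega : 1 ≤ N),
          ← ENNReal.ofReal_mul (by positivity), ← ENNReal.ofReal_mul (by positivity), mul_left_comm,
          ← Real.exp_add]
        congr 3; ring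

theorem variance_cliqueCount_le (n j : ℕ) {α : ℝ}
    (hα : (2 * ((j + 3 : ℕ) : ℝ) - 3) / (2 * ((j + 3 : ℕ) : ℝ) - 2) < α) (hα' : α < 1) :
    ∃ C : ℝ, 0 < C ∧ ∀ (N₀ : ℕ), 2 ≤ N₀ →
      ∀ (Ω : Type*) [MeasurableSpace Ω] (P : Measure Ω) [IsProbabilityMeasure P]
        (N : Ω → ℕ) (X : ℕ → Ω → EuclideanSpace ℝ (Fin (n + 2))),
        IsVertexProcess (n + 2) N₀ α P N X → ∀ u ∈ Set.Ioo 0 (radius (n + 2) N₀),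
        MemLp (fun ω => (cliqueCount (j + 3) (radius (n + 2) N₀) (vertices N X ω)
          (polarPoint (n + 2) (radius (n + 2) N₀) (u, 0)) : ℝ)) 2 P ∧
        variance (fun ω => (cliqueCount (j + 3) (radius (n + 2) N₀) (vertices N X ω)
          (polarPoint (n + 2) (radius (n + 2) N₀) (u, 0)) : ℝ)) P ≤
        C * Real.exp (((n + 1) / 2 + (j + 1) * ((n + 1) * (1 - α))) * u) := by
  have hj0 : (0 : ℝ) ≤ j := Nat.cast_nonneg j
  have hn0 : (0 : ℝ) ≤ n := Nat.cast_nonneg n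
  -- With m = j + 3, this is the assumption on α; multiplied by n + 1 = d - 1 it becomes (j+2)η < a.
  have hα2 : (j + 2) * (1 - α) < 1 / 2 := by
    push_cast at hα
    rw [div_lt_iff₀ (by linarith)] at hα
    linarith
  have hα0 : 0 < α := by nlinarith
  obtain ⟨K, hK, hNB⟩ := exists_neighbourBound n hα0
  set a : ℝ := (n + 1) / 2 with ha
  set η : ℝ := (n + 1) * (1 - α) with hη
  have hη0 : 0 < η := mul_pos (by linarith) (by linarith)
  have hjη : (j + 2) * η < a := by
    have := mul_lt_mul_of_pos_left hα2 (show (0 : ℝ) < n + 1 by linarith)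
    rw [hη, ha]; linarith
  have hηa : η < a := by nlinarith
  -- Half of the available slack: it is spent once in the integral over B and once in that over A.
  set δ : ℝ := (a - (j + 2) * η) / 2 with hδ
  have hδ0 : 0 < δ := by rw [hδ]; linarith
  set M : ℝ := 1 + K * (1 / δ) + K * (1 / (a - η)) + K * (1 / η) with hM
  have h1 : 0 < K * (1 / δ) := by positivity
  have h2 : 0 < K * (1 / (a - η)) := mul_pos hK (one_div_pos.2 (by linarith))
  have h3 : 0 < K * (1 / η) := by positivity
  have hM0 : 0 < M := by rw [hM]; linarith
  refine ⟨(Fintype.card (OverlapPattern (j + 2)) + 1) * (2 * M ^ (2 * j + 3)), by positivity, ?_⟩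
  intro N₀ hN₀ Ω _ P _ N X hX u hu
  set R := radius (n + 2) N₀
  set p := polarPoint (n + 2) R (u, 0)
  have hhp : R - dH 0 p = u := by
    have : dH 0 p = R - u := dH_zero_polarPoint hu.2.le _
    rw [this]; ring
  have hp : p ∈ hypBall (n + 2) R := ⟨norm_polarPoint_lt hu.2.le _, by linarith [hu.1]⟩
  have hν : IsProbabilityMeasure (vertexLaw (n + 2) α R) := by
    rw [← hX.law_point 0]
    exact Measure.isProbabilityMeasure_map (hX.measurable_point 0).aemeasurable
  have H := hNB N₀ hN₀
  set Q : (Fin (j + 2) → EuclideanSpace ℝ (Fin (n + 2))) → Prop :=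
    IsOrderedClique (fun x y => dH x y ≤ R) (fun x => R - dH 0 x) p with hQ
  have hofM : ∀ x : ℝ, K * x ≤ M → ENNReal.ofReal K * ENNReal.ofReal x ≤ ENNReal.ofReal M :=
    fun x hx => by rw [← ENNReal.ofReal_mul hK.le]; exact ENNReal.ofReal_le_ofReal hx
  have hB : ∀ π : OverlapPattern (j + 2),
      ∫⁻ y, ind (Q fun i => y (π.2.1.1 i)) * ind (Q fun i => y (π.2.1.2 i))
        ∂Measure.pi (fun _ => (N₀ : NNReal) • vertexLaw (n + 2) α R) ≤
      ENNReal.ofReal (2 * M ^ (2 * j + 3) * Real.exp ((a + (j + 1) * η) * u)) := fun π => by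
    refine (H.lintegral_pattern_le (M := ENNReal.ofReal M) (δ := δ) hη0 hηa hδ0 ?_
      (hofM _ (by linarith)) (hofM _ (by linarith)) (hofM _ (by linarith)) (by linarith) π.1.2
      π.2.1.1 π.2.1.2 π.2.2 hp).trans_eq ?_
    · rw [ENNReal.one_le_ofReal]; linarith
    · rw [ENNReal.ofReal_mul (by positivity), ENNReal.ofReal_mul (by positivity),
        ENNReal.ofReal_pow hM0.le, hhp, ENNReal.ofReal_ofNat]
      rfl
  have hcount : ∀ᵐ ω ∂P, (cliqueCount (j + 3) R (vertices N X ω) p : ℝ) =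
      (tupleCount Q (N ω) fun i => X i ω).toReal := by
    filter_upwards [ae_pairwise_ne hX.measurable_point hX.law_point hX.indep_points
      (vertexLaw_singleton n α R)] with ω hω
    exact ncard_tuples_eq Q hω
  obtain ⟨hmem, hvar⟩ := variance_tupleCount_le hX.measurable_card hX.law_card hX.measurable_point
    hX.law_point hX.indep_points hX.indep_card (H.measurableSet_isOrderedClique p) (by positivity) hB
    hcount
  refine ⟨hmem, hvar.trans ?_⟩
  rw [← mul_assoc]
  gcongr
  linarith

end HypRGG

theorem proposition3p4 (d m : ℕ) (hd : 2 ≤ d) (hm : 3 ≤ m) (α : ℝ)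
    (hα : (2 * (m : ℝ) - 3) / (2 * (m : ℝ) - 2) < α) (hα' : α < 1) :
    ∃ C c₁ : ℝ, 0 < C ∧ 0 < c₁ ∧
      ∀ (n : ℕ), 1 ≤ n →
      ∀ (Ω : Type*) [MeasurableSpace Ω] (P : Measure Ω) [IsProbabilityMeasure P]
        (N : Ω → ℕ) (X : ℕ → Ω → EuclideanSpace ℝ (Fin d)),
        HypRGG.IsVertexProcess d n α P N X →
      ∀ u ∈ Set.Ioo 0 (HypRGG.radius d n),
        MemLp (fun ω => (HypRGG.cliqueCount m (HypRGG.radius d n) (HypRGG.vertices N X ω)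
          (HypRGG.polarPoint d (HypRGG.radius d n) (u, 0)) : ℝ)) 2 P ∧
        variance (fun ω => (HypRGG.cliqueCount m (HypRGG.radius d n) (HypRGG.vertices N X ω)
          (HypRGG.polarPoint d (HypRGG.radius d n) (u, 0)) : ℝ)) P ≤
          C * Real.exp (c₁ * HypRGG.omega d n) *
            Real.exp (1 / 2 * ((d : ℝ) - 1) *
              (2 * (m : ℝ) - 3 - (2 * (m : ℝ) - 4) * α) * u) := by
  obtain ⟨D, rfl⟩ := Nat.exists_eq_add_of_le' hd
  obtain ⟨j, rfl⟩ := Nat.exists_eq_add_of_le' hm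
  obtain ⟨C, hC, h⟩ := HypRGG.variance_cliqueCount_le D j hα hα'
  obtain ⟨b, hb⟩ := HypRGG.exists_le_omega D
  -- As b ≤ ω_n, the factor exp(-b) exp(ω_n) is at least 1.
  refine ⟨C * Real.exp (-b), 1, by positivity, one_pos, ?_⟩
  intro n hn Ω _ P _ N X hX u hu
  -- For n = 1 the radius is 0 and no u exists; from n = 2 on, the radii have a positive lower
  -- bound.
  have hn2 : 2 ≤ n := by
    rcases hn.eq_or_lt with rfl | hn
    · have h1 := hu.1.trans hu.2
      simp [HypRGG.radius] at h1
    · exact hn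
  obtain ⟨hmem, hvar⟩ := h n hn2 Ω P N X hX u hu
  refine ⟨hmem, hvar.trans ?_⟩
  have h1 : 1 ≤ Real.exp (-b) * Real.exp (1 * HypRGG.omega (D + 2) n) := by
    rw [← Real.exp_add]
    exact Real.one_le_exp (by linarith [hb n])
  have h2 : 1 / 2 * (((D + 2 : ℕ) : ℝ) - 1) *
      (2 * ((j + 3 : ℕ) : ℝ) - 3 - (2 * ((j + 3 : ℕ) : ℝ) - 4) * α) * u =
      (((D : ℝ) + 1) / 2 + (j + 1) * ((D + 1) * (1 - α))) * u := by
    push_cast; ring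
  rw [h2, mul_assoc C]
  gcongr
  exact le_mul_of_one_le_right hC.le h1
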